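/- **Conventions.** A metric probability space $(\Omega,d,\mu)$ is a connected metric space with a separable, non-atomic Borel probability measure $\mu$. For Borel $A$ put $\mu^+(A)=\liminf_{h\to0^+}\frac{\mu(A_h)-\mu(A)}{h}$, $A_h=\{x:d(x,A)<h\}$; the isoperimetric profile $I_{(\Omega,d,\mu)}$ is the largest function $I:[0,1]\to[0,\infty)$ with $\mu^+(A)\ge I(\mu(A))$ for all Borel $A$. It is assumed that $I_{(\Omega,d,\mu)}$ is concave, continuous, (weakly) increasing on $(0,1/2)$, symmetric about $1/2$, and zero at $0$. $Lip(\Omega)$ is the set of $f:\Omega\to\mathbb R$ that are Lipschitz on every ball, $|\nabla f(x)|=\limsup_{y\to x,\,y\ne x}\frac{|f(x)-f(y)|}{d(x,y)}$ (zero at isolated points), and it is assumed that for every $f\in Lip(\Omega)$ and $c\in\mathbb R$, $|\nabla f|=0$ a.e. on $\{f=c\}$. For measurable $f$ let $f^*_\mu(s)=\inf\{t\ge0:\mu\{|f|>t\}\le s\}$. A rearrangement invariant (r.i.) space $X(\Omega)$ is a Banach function space (with the Fatou property) whose norm depends only on $f^*_\mu$. Its representation $\bar X=\bar X(0,1)$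 is given by $\|h\|_{\bar X}=\sup\{\int_0^1 g^*_\mu(s)h^*(s)\,ds:\|g\|_{X'(\Omega)}\le1\}$, where $X'$ is the associate space, so that $\|f\|_{X(\Omega)}=\|f^*_\mu\|_{\bar X}$; the corresponding space $X(\Omega_1)$ over another metric probability space $(\Omega_1,d_1,\mu_1)$ has the norm $\|f\|_{X(\Omega_1)}=\|f^*_{\mu_1}\|_{\bar X}$. $(\Omega,d,\mu)$ is of *isoperimetric Hardy type* if, with $I=I_{(\Omega,d,\mu)}$, the following are equivalent for all r.i. spaces $X=X(\Omega)$, $Y=Y(\Omega)$: 1. there is a constant $c>0$ with $\|f-\int_\Omega f\,d\mu\|_Y\le c\,\||\nabla f|\|_X$ for all $f\in Lip(\Omega)$; 2. there is a constant $c_1>0$ with $\|Q_If\|_{\bar Y}\le c_1\|f\|_{\bar X}$ for all $f\ge0$ in $\bar X$ supported in $(0,1/2)$, where $Q_If(t)=\int_t^1 f(s)\frac{ds}{I(s)}$. (In a Poincaré inequality as in 1, nothing is claimed for $f$ with $|\nabla f|\notin X$; for the other $f\in Lip(\Omega)$ the inequality includes the integrability of $f$.) **Theorem (transference principle).** Let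 $(\Omega,d,\mu)$ be a metric probability space of isoperimetric Hardy type, and let $(\Omega_1,d_1,\mu_1)$ be a metric probability space such that for some $c>0$ $$I_{(\Omega_1,d_1,\mu_1)}(t)\ge c\,I_{(\Omega,d,\mu)}(t),\qquad t\in(0,1/2].$$ Let $X(\Omega),Y(\Omega)$ be r.i. spaces for which there is a constant $c>0$ with $$\Big\|g-\int_\Omega g\,d\mu\Big\|_{Y(\Omega)}\le c\,\big\||\nabla g|\big\|_{X(\Omega)}\quad\text{for all }g\in Lip(\Omega).$$ Then there is a constant $c_1>0$ such that $$\Big\|g-\int_{\Omega_1}g\,d\mu_1\Big\|_{Y(\Omega_1)}\le c_1\,\big\||\nabla g|\big\|_{X(\Omega_1)}\quad\text{for all }g\in Lip(\Omega_1).$$ -/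

import Mathlib

open MeasureTheory Set Filter Topology
open scoped ENNReal NNReal

namespace IsoTransfer

noncomputable section

/-! ### Rearrangements -/

/-- The decreasing rearrangement `f*(s) = inf {t ≥ 0 : μ {f > t} ≤ s}` of a function
`f ≥ 0` with respect to `μ`. Rearrangements of signed functions are those of `|f|`. -/
def rearr {α : Type*} [MeasurableSpace α] (μ : Measure α) (f : α → ℝ≥0∞) (s : ℝ) : ℝ≥0∞ :=
  sInf {t : ℝ≥0∞ | μ {x | t < f x} ≤ ENNReal.ofReal s}

/-- Lebesgue measure on the interval `(0,1)`. -/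
def unitMeasure : Measure ℝ := volume.restrict (Ioo (0 : ℝ) 1)

/-! ### Rearrangement invariant spaces -/

/-- A rearrangement invariant Banach function norm over `μ`, defined on the cone of
`μ`-measurable functions with values in `[0,∞]`. The associated r.i. space consists of the
measurable `f` such that the norm of `|f|` is finite. -/
structure RINorm {α : Type*} [MeasurableSpace α] (μ : Measure α) where
  /-- the value of the norm on a nonnegative function -/
  norm : (α → ℝ≥0∞) → ℝ≥0∞
  norm_eq_zero_iff : ∀ f, AEMeasurable f μ → (norm f = 0 ↔ f =ᵐ[μ] 0)
  norm_smul : ∀ (a : ℝ≥0) (f), AEMeasurable f μ →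
    norm (fun x => (a : ℝ≥0∞) * f x) = (a : ℝ≥0∞) * norm f
  norm_add_le : ∀ f g, AEMeasurable f μ → AEMeasurable g μ →
    norm (fun x => f x + g x) ≤ norm f + norm g
  norm_mono : ∀ f g, AEMeasurable f μ → AEMeasurable g μ →
    (∀ᵐ x ∂μ, g x ≤ f x) → norm g ≤ norm f
  /-- the Fatou property -/
  norm_iSup : ∀ f : ℕ → α → ℝ≥0∞, (∀ n, AEMeasurable (f n) μ) →
    (∀ᵐ x ∂μ, Monotone fun n => f n x) →
    norm (fun x => ⨆ n, f n x) = ⨆ n, norm (f n)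
  norm_indicator_lt_top : ∀ E, MeasurableSet E → μ E < ∞ → norm (E.indicator 1) < ∞
  lintegral_le : ∀ E, MeasurableSet E → μ E < ∞ →
    ∃ C : ℝ≥0, ∀ f, AEMeasurable f μ → ∫⁻ x in E, f x ∂μ ≤ (C : ℝ≥0∞) * norm f
  /-- rearrangement invariance -/
  norm_congr_rearr : ∀ f g, AEMeasurable f μ → AEMeasurable g μ →
    rearr μ f = rearr μ g → norm f = norm g

/-- The associate norm: `‖h‖_{X'} = sup {∫ |g h| dμ : ‖g‖_X ≤ 1}`. -/
def RINorm.assoc {α : Type*} [MeasurableSpace α] {μ : Measure α} (X : RINorm μ)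
    (h : α → ℝ≥0∞) : ℝ≥0∞ :=
  ⨆ (g : α → ℝ≥0∞) (_ : AEMeasurable g μ) (_ : X.norm g ≤ 1), ∫⁻ x, g x * h x ∂μ

/-- The norm of the representation `X̄` on `(0,1)` of an r.i. space `X` over a probability
space: `‖h‖_{X̄} = sup {∫₀¹ g*(s) h*(s) ds : ‖g‖_{X'} ≤ 1}`. Over a nonatomic
probability space this is the unique r.i. norm on `(0,1)` with `‖f‖_X = ‖f*‖_{X̄}`. -/
def RINorm.bar {α : Type*} [MeasurableSpace α] {μ : Measure α} (X : RINorm μ)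
    (h : ℝ → ℝ≥0∞) : ℝ≥0∞ :=
  ⨆ (g : α → ℝ≥0∞) (_ : AEMeasurable g μ) (_ : X.assoc g ≤ 1),
    ∫⁻ s in Ioo (0 : ℝ) 1, rearr μ g s * rearr unitMeasure h s

/-- The norm of `X(Ω₁)`, the space over another measure `ν` which has the same representation
`X̄` on `(0,1)` as the r.i. space `X = X(Ω)`: `‖f‖_{X(Ω₁)} = ‖f*_ν‖_{X̄}`. -/
def RINorm.normOn {α : Type*} [MeasurableSpace α] {μ : Measure α} (X : RINorm μ)
    {β : Type*} [MeasurableSpace β] (ν : Measure β) (f : β → ℝ≥0∞) : ℝ≥0∞ :=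
  X.bar (rearr ν f)

/-! ### Metric probability spaces and isoperimetry -/

section Metric

variable {Ω : Type*} [MetricSpace Ω]

/-- `f ∈ Lip(Ω)`: `f` is Lipschitz on every ball. -/
def LipOnBalls (f : Ω → ℝ) : Prop :=
  ∀ (x : Ω) (r : ℝ), ∃ K : ℝ≥0, LipschitzOnWith K f (Metric.ball x r)

/-- The modulus of the gradient `|∇f|(x) = limsup_{y → x, y ≠ x} |f x - f y| / d(x,y)`.
It is zero at isolated points, where the punctured neighbourhood filter is trivial. -/
def gradMod (f : Ω → ℝ) (x : Ω) : ℝ≥0∞ :=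
  limsup (fun y => ENNReal.ofReal (|f x - f y| / dist x y)) (𝓝[≠] x)

variable [MeasurableSpace Ω]

/-- The perimeter (Minkowski content) `μ⁺(A) = liminf_{h → 0+} (μ(A_h) - μ(A)) / h`, where
`A_h` is the open `h`-neighbourhood of `A`. -/
def perimeter (μ : Measure Ω) (A : Set Ω) : ℝ≥0∞ :=
  liminf (fun h : ℝ => (μ (Metric.thickening h A) - μ A) / ENNReal.ofReal h) (𝓝[>] 0)

/-- The isoperimetric profile: the largest function `I` on `[0,1]` such that
`μ⁺(A) ≥ I(μ(A))` for all Borel sets `A`. -/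
def profile (μ : Measure Ω) (t : ℝ) : ℝ≥0∞ :=
  ⨅ (A : Set Ω) (_ : MeasurableSet A) (_ : μ A = ENNReal.ofReal t), perimeter μ A

/-- The shape of isoperimetric profiles: finite, continuous and concave on
`[0,1]`, increasing on `(0,1/2)`, symmetric about `1/2`, vanishing at `0`. -/
structure ProfileShape (I : ℝ → ℝ≥0∞) : Prop where
  ne_top : ∀ t ∈ Icc (0 : ℝ) 1, I t ≠ ∞
  continuousOn : ContinuousOn I (Icc 0 1)
  concaveOn : ConcaveOn ℝ (Icc 0 1) fun t => (I t).toReal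
  monotoneOn : MonotoneOn I (Ioo 0 (1 / 2))
  symm : ∀ t ∈ Icc (0 : ℝ) 1, I (1 - t) = I t
  zero : I 0 = 0

/-- Metric probability spaces `(Ω, d, μ)`: `Ω` is connected, `μ` is a separable nonatomic
Borel probability measure, the isoperimetric profile has the usual shape, and the gradient
of a function in `Lip(Ω)` vanishes almost everywhere on each of its level sets. -/
structure MetricProbSpace (μ : Measure Ω) : Prop where
  borel : BorelSpace Ω
  connected : ConnectedSpace Ω
  prob : IsProbabilityMeasure μ
  separable : MeasureTheory.IsSeparable μ
  nonatomic : ∀ A, MeasurableSet A → 0 < μ A →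
    ∃ B, B ⊆ A ∧ MeasurableSet B ∧ 0 < μ B ∧ μ B < μ A
  profile_shape : ProfileShape (profile μ)
  gradMod_level : ∀ f : Ω → ℝ, LipOnBalls f → ∀ c : ℝ, ∀ᵐ x ∂μ, f x = c → gradMod f x = 0

/-- The Poincaré inequality `‖g - ∫ g dμ‖_Y ≤ c ‖|∇g|‖_X` for all `g ∈ Lip(Ω)`, with some
constant `c`. When `|∇g| ∉ X` the right side is infinite and nothing is claimed;
otherwise the claim includes that `g` is integrable, so that its mean exists. -/
def PoincareInequality (μ : Measure Ω) (normY normX : (Ω → ℝ≥0∞) → ℝ≥0∞) : Prop :=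
  ∃ c : ℝ, 0 < c ∧ ∀ g : Ω → ℝ, LipOnBalls g → normX (gradMod g) < ∞ →
    Integrable g μ ∧
    normY (fun x => ‖g x - ∫ y, g y ∂μ‖ₑ) ≤ ENNReal.ofReal c * normX (gradMod g)

/-- The isoperimetric Hardy operator `Q_I f(t) = ∫_t^1 f(s) ds / I(s)` on functions `f ≥ 0`. -/
def hardyOp (I f : ℝ → ℝ≥0∞) (t : ℝ) : ℝ≥0∞ :=
  ∫⁻ s in Ioo t 1, f s / I s

/-- Boundedness of `Q_I` from `X̄` to `Ȳ` on the nonnegative functions in `X̄` that are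
supported in `(0,1/2)`. -/
def HardyBounded (I : ℝ → ℝ≥0∞) (normX normY : (ℝ → ℝ≥0∞) → ℝ≥0∞) : Prop :=
  ∃ c : ℝ, 0 < c ∧ ∀ f : ℝ → ℝ≥0∞, AEMeasurable f unitMeasure →
    (∀ s, s ∉ Ioo (0 : ℝ) (1 / 2) → f s = 0) → normX f < ∞ →
    normY (hardyOp I f) ≤ ENNReal.ofReal c * normX f

/-- `(Ω, d, μ)` is of isoperimetric Hardy type: for all r.i. spaces `X`, `Y` on `Ω`, the
Poincaré inequality holds if and only if the isoperimetric Hardy operator of the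
isoperimetric profile is bounded from `X̄` to `Ȳ` in the above sense. -/
def IsoHardyType (μ : Measure Ω) : Prop :=
  ∀ X Y : RINorm μ,
    PoincareInequality μ Y.norm X.norm ↔ HardyBounded (profile μ) X.bar Y.bar

end Metric

end

end IsoTransfer

namespace IsoTransfer

/-! ### Decreasing rearrangements -/

section Rearrangement

variable {α : Type*} [MeasurableSpace α] {μ : Measure α}

/-! Isoperimetric Hardy type turns the Poincaré inequality on Ω into boundedness of `hardyOp` from
X̄ to Ȳ, a statement on (0,1) that sees Ω only through its profile I. The task is to recover from it
a Poincaré inequality on Ω₁, whose profile is at least cI on (0,1/2].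

Let f ∈ Lip(Ω₁) be positive on at most half of the space. Put b_k = 2^(-k-1) and let T_k be the
rearrangement of f⁺ at b_k. A coarea argument bounds c I(b_{k+1}) (T_{k+1} - T_k) by the integral of
|∇f| over the band {T_k < f < T_{k+1}} (`lintegral_perimeter_le`, `mul_le_setLIntegral_gradMod`).
Spreading each such integral uniformly over (b_{k+1}, b_k) gives a step function φ. The band has
measure at most b_{k+1}, so φ is dominated by |∇f| in the Hardy-Littlewood-Pólya order and its X̄
norm is at most that of |∇f| (`lintegral_transplant_sub_le`, `RINorm.bar_le_normOn`). Telescoping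
bounds T_k by a multiple of Q_I φ(b_k), and sampling at dyadic points costs only a dilation
(`lintegral_mul_le_of_dilation`). Working with discrete levels avoids differentiating the
rearrangement of f.

For general g this is applied to g - m and m - g with m a median; the embeddings L^∞ ⊂ Y ⊂ L¹ then
replace m by the mean. -/

instance isProbabilityMeasure_unitMeasure : IsProbabilityMeasure unitMeasure :=
  ⟨by simp [unitMeasure]⟩

/-- The infimum defining the rearrangement is attained. Measures of increasing unions are continuous
for arbitrary sets, so f need not be measurable. -/
theorem measure_rearr_lt_le (f : α → ℝ≥0∞) (s : ℝ) :
    μ {x | rearr μ f s < f x} ≤ ENNReal.ofReal s := by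
  obtain ⟨u, hu, hmem⟩ : ∃ u : ℕ → ℝ≥0∞, Tendsto u atTop (𝓝 (rearr μ f s)) ∧
      ∀ n, u n ∈ {t : ℝ≥0∞ | μ {x | t < f x} ≤ ENNReal.ofReal s} := by
    obtain ⟨u, -, hu, hmem⟩ := exists_seq_tendsto_sInf
      (S := {t : ℝ≥0∞ | μ {x | t < f x} ≤ ENNReal.ofReal s}) ⟨∞, by simp⟩ (OrderBot.bddBelow _)
    exact ⟨u, hu, hmem⟩
  -- Intersecting over the tail k ≥ n makes the sets increase with n without using monotonicity of
  -- `u`.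
  have hsub : {x | rearr μ f s < f x} ⊆ ⋃ n, ⋂ k ≥ n, {x | u k < f x} := by
    intro x hx
    obtain ⟨n, hn⟩ := eventually_atTop.1 (hu.eventually (gt_mem_nhds hx))
    exact mem_iUnion.2 ⟨n, mem_iInter₂.2 fun k hk => hn k hk⟩
  refine (measure_mono hsub).trans ?_
  rw [Monotone.measure_iUnion]
  · exact iSup_le fun n => (measure_mono (iInter₂_subset n le_rfl)).trans (hmem n)
  · exact fun n m hnm => iInter₂_mono' fun k hk => ⟨k, hnm.trans hk, subset_rfl⟩

theorem rearr_le_iff {f : α → ℝ≥0∞} {s : ℝ} {t : ℝ≥0∞} :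
    rearr μ f s ≤ t ↔ μ {x | t < f x} ≤ ENNReal.ofReal s :=
  ⟨fun h => (measure_mono fun _ hx => h.trans_lt hx).trans (measure_rearr_lt_le f s),
    fun h => sInf_le h⟩

theorem lt_rearr_iff {f : α → ℝ≥0∞} {s : ℝ} {t : ℝ≥0∞} :
    t < rearr μ f s ↔ ENNReal.ofReal s < μ {x | t < f x} := by
  simpa using rearr_le_iff.not

theorem rearr_antitone (f : α → ℝ≥0∞) : Antitone (rearr μ f) := fun _ _ hst =>
  rearr_le_iff.2 ((measure_rearr_lt_le f _).trans (ENNReal.ofReal_le_ofReal hst))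

theorem measurable_rearr (f : α → ℝ≥0∞) : Measurable (rearr μ f) :=
  (rearr_antitone f).measurable

theorem rearr_mono {f g : α → ℝ≥0∞} (h : ∀ x, f x ≤ g x) (s : ℝ) : rearr μ f s ≤ rearr μ g s :=
  rearr_le_iff.2 ((measure_mono fun x hx => lt_of_lt_of_le hx (h x)).trans
    (measure_rearr_lt_le g s))

/-- The sum can exceed the bound only on the union of two exceptional sets of measure at most s
each; this is the source of the dilation by 2. -/
theorem rearr_add_le (f g : α → ℝ≥0∞) {s : ℝ} (hs : 0 ≤ s) :
    rearr μ (fun x => f x + g x) (2 * s) ≤ rearr μ f s + rearr μ g s := by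
  rw [rearr_le_iff]
  have hsub : {x | rearr μ f s + rearr μ g s < f x + g x} ⊆
      {x | rearr μ f s < f x} ∪ {x | rearr μ g s < g x} := by
    intro x hx
    by_contra hn
    simp only [mem_union, mem_ofPred_eq, not_or, not_lt] at hn
    exact (not_le.2 hx) (add_le_add hn.1 hn.2)
  calc μ {x | rearr μ f s + rearr μ g s < f x + g x}
      ≤ ENNReal.ofReal s + ENNReal.ofReal s := (measure_mono hsub).trans ((measure_union_le _ _).trans
        (add_le_add (measure_rearr_lt_le f s) (measure_rearr_lt_le g s)))
    _ = ENNReal.ofReal (2 * s) := by rw [two_mul, ENNReal.ofReal_add hs hs]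

theorem rearr_const_le (c : ℝ≥0∞) (s : ℝ) : rearr μ (fun _ => c) s ≤ c :=
  rearr_le_iff.2 (by simp)

theorem rearr_const [IsProbabilityMeasure μ] (c : ℝ≥0∞) {s : ℝ} (hs : s < 1) :
    rearr μ (fun _ => c) s = c := by
  refine le_antisymm (rearr_const_le c s) (le_of_forall_lt fun t ht => ?_)
  rw [lt_rearr_iff]
  simpa [ht] using hs

/-- A rearrangement has the same distribution function as the original function. -/
theorem unitMeasure_lt_rearr [IsProbabilityMeasure μ] (f : α → ℝ≥0∞) (t : ℝ≥0∞) :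
    unitMeasure {s | t < rearr μ f s} = μ {x | t < f x} := by
  have hset : {s | t < rearr μ f s} ∩ Ioo 0 1 = Ioo 0 (μ {x | t < f x}).toReal := by
    ext s
    simp only [mem_inter_iff, mem_ofPred_eq, mem_Ioo, lt_rearr_iff]
    have h1 : (μ {x | t < f x}).toReal ≤ 1 := by
      simpa using ENNReal.toReal_mono ENNReal.one_ne_top (prob_le_one (μ := μ) (s := {x | t < f x}))
    constructor
    · rintro ⟨h, h0, -⟩
      exact ⟨h0, (ENNReal.ofReal_lt_iff_lt_toReal h0.le (measure_ne_top _ _)).1 h⟩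
    · rintro ⟨h0, h⟩
      exact ⟨(ENNReal.ofReal_lt_iff_lt_toReal h0.le (measure_ne_top _ _)).2 h, h0, h.trans_le h1⟩
  have hm : MeasurableSet {s | t < rearr μ f s} := measurable_rearr f measurableSet_Ioi
  rw [unitMeasure, Measure.restrict_apply hm, hset]
  simp

theorem rearr_rearr [IsProbabilityMeasure μ] (f : α → ℝ≥0∞) :
    rearr unitMeasure (rearr μ f) = rearr μ f := by
  funext s
  refine eq_of_forall_ge_iff fun t => ?_
  rw [rearr_le_iff, rearr_le_iff, unitMeasure_lt_rearr]

/-- Equimeasurability of a function and its rearrangement. -/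
theorem lintegral_comp_rearr [IsProbabilityMeasure μ] {f : α → ℝ≥0∞} (hf : AEMeasurable f μ)
    {F : ℝ≥0∞ → ℝ≥0∞} (hF : Measurable F) :
    ∫⁻ s, F (rearr μ f s) ∂unitMeasure = ∫⁻ x, F (f x) ∂μ := by
  have hmap : Measure.map (rearr μ f) unitMeasure = Measure.map f μ := by
    have : IsProbabilityMeasure (Measure.map f μ) := Measure.isProbabilityMeasure_map hf
    have : IsProbabilityMeasure (Measure.map (rearr μ f) unitMeasure) :=
      Measure.isProbabilityMeasure_map (measurable_rearr f).aemeasurable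
    refine Measure.ext_of_Iic _ _ fun a => ?_
    rw [← compl_Ioi, prob_compl_eq_one_sub measurableSet_Ioi,
      prob_compl_eq_one_sub measurableSet_Ioi,
      Measure.map_apply (measurable_rearr f) measurableSet_Ioi,
      Measure.map_apply_of_aemeasurable hf measurableSet_Ioi]
    congr 1
    exact unitMeasure_lt_rearr f a
  rw [← lintegral_map hF (measurable_rearr f), hmap, lintegral_map' hF.aemeasurable hf]

theorem lintegral_Ioo_rearr [IsProbabilityMeasure μ] {f : α → ℝ≥0∞} (hf : AEMeasurable f μ) :
    ∫⁻ s in Ioo (0 : ℝ) 1, rearr μ f s = ∫⁻ x, f x ∂μ :=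
  lintegral_comp_rearr hf measurable_id

/-- The layer cake formula for a weight which is a decreasing rearrangement. -/
theorem lintegral_rearr_mul [IsProbabilityMeasure μ] (g : α → ℝ≥0∞) {h : ℝ → ℝ≥0∞}
    (hh : Measurable h) :
    ∫⁻ s in Ioo (0 : ℝ) 1, rearr μ g s * h s =
      ∫⁻ r in Ioi (0 : ℝ),
        ∫⁻ s in Ioo (0 : ℝ) (μ {x | ENNReal.ofReal r < g x}).toReal, h s := by
  -- Each value of the weight is the length of the set of levels below it. After Tonelli, the
  -- superlevel sets of a rearrangement are initial intervals.
  have hcake : ∀ w : ℝ≥0∞, w = ∫⁻ r in Ioi (0 : ℝ),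
      {r : ℝ | ENNReal.ofReal r < w}.indicator 1 r := by
    intro w
    have hm : MeasurableSet {r : ℝ | ENNReal.ofReal r < w} :=
      ENNReal.measurable_ofReal measurableSet_Iio
    rw [lintegral_indicator_one hm, Measure.restrict_apply hm]
    rcases eq_or_ne w ∞ with rfl | hw
    · simp
    · have : {r : ℝ | ENNReal.ofReal r < w} ∩ Ioi 0 = Ioo 0 w.toReal := by
        ext r
        simp only [mem_inter_iff, mem_ofPred_eq, mem_Ioi, mem_Ioo]
        constructor
        · rintro ⟨h1, h0⟩
          exact ⟨h0, (ENNReal.ofReal_lt_iff_lt_toReal h0.le hw).1 h1⟩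
        · rintro ⟨h0, h1⟩
          exact ⟨(ENNReal.ofReal_lt_iff_lt_toReal h0.le hw).2 h1, h0⟩
      rw [this]
      simp [ENNReal.ofReal_toReal hw]
  have hS : MeasurableSet {p : ℝ × ℝ | ENNReal.ofReal p.2 < rearr μ g p.1} :=
    measurableSet_lt (ENNReal.measurable_ofReal.comp measurable_snd)
      ((measurable_rearr g).comp measurable_fst)
  calc ∫⁻ s in Ioo (0 : ℝ) 1, rearr μ g s * h s
      = ∫⁻ s in Ioo (0 : ℝ) 1, ∫⁻ r in Ioi (0 : ℝ),
          {p : ℝ × ℝ | ENNReal.ofReal p.2 < rearr μ g p.1}.indicator (fun p => h p.1) (s, r) := by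
        refine lintegral_congr fun s => ?_
        conv_lhs => rw [hcake (rearr μ g s)]
        rw [← lintegral_mul_const]
        · refine lintegral_congr fun r => ?_
          by_cases hr : ENNReal.ofReal r < rearr μ g s <;> simp [indicator, hr]
        · exact measurable_one.indicator (ENNReal.measurable_ofReal measurableSet_Iio)
    _ = ∫⁻ r in Ioi (0 : ℝ), ∫⁻ s in Ioo (0 : ℝ) 1,
          {p : ℝ × ℝ | ENNReal.ofReal p.2 < rearr μ g p.1}.indicator (fun p => h p.1) (s, r) :=
        lintegral_lintegral_swap ((hh.comp measurable_fst).indicator hS).aemeasurable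
    _ = _ := by
        refine lintegral_congr fun r => ?_
        have h1 : (μ {x | ENNReal.ofReal r < g x}).toReal ≤ 1 := by
          simpa using ENNReal.toReal_mono ENNReal.one_ne_top
            (prob_le_one (μ := μ) (s := {x | ENNReal.ofReal r < g x}))
        rw [← lintegral_indicator measurableSet_Ioo, ← lintegral_indicator measurableSet_Ioo]
        refine lintegral_congr fun s => ?_
        by_cases h0 : 0 < s
        · have hiff : ENNReal.ofReal r < rearr μ g s ↔
              s < (μ {x | ENNReal.ofReal r < g x}).toReal := by
            rw [lt_rearr_iff, ENNReal.ofReal_lt_iff_lt_toReal h0.le (measure_ne_top _ _)]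
          by_cases h2 : s < (μ {x | ENNReal.ofReal r < g x}).toReal
          · simp [indicator, h0, hiff, h2, h2.trans_le h1]
          · simp [indicator, hiff, h2]
        · simp [indicator, h0]

/-- Hardy's lemma. -/
theorem lintegral_rearr_mul_le [IsProbabilityMeasure μ] (g : α → ℝ≥0∞) {h k : ℝ → ℝ≥0∞}
    (hh : Measurable h) (hk : Measurable k)
    (H : ∀ τ ∈ Ioc (0 : ℝ) 1, ∫⁻ s in Ioo 0 τ, h s ≤ ∫⁻ s in Ioo 0 τ, k s) :
    ∫⁻ s in Ioo (0 : ℝ) 1, rearr μ g s * h s ≤ ∫⁻ s in Ioo (0 : ℝ) 1, rearr μ g s * k s := by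
  rw [lintegral_rearr_mul g hh, lintegral_rearr_mul g hk]
  refine lintegral_mono fun r => ?_
  have h1 : (μ {x | ENNReal.ofReal r < g x}).toReal ≤ 1 := by
    simpa using ENNReal.toReal_mono ENNReal.one_ne_top
      (prob_le_one (μ := μ) (s := {x | ENNReal.ofReal r < g x}))
  rcases (ENNReal.toReal_nonneg (a := μ {x | ENNReal.ofReal r < g x})).eq_or_lt with h0 | h0
  · simp [← h0]
  · exact H _ ⟨h0, h1⟩

/-- If `∫ (φ - r)⁺ ≤ ∫ (h - r)⁺` for all levels `r`, then `∫₀^τ φ* ≤ ∫₀^τ h*`. -/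
theorem lintegral_rearr_le_of_forall_sub {β : Type*} [MeasurableSpace β] {ν : Measure β}
    [IsProbabilityMeasure μ] [IsProbabilityMeasure ν] {φ : β → ℝ≥0∞} {h : α → ℝ≥0∞}
    (hφ : AEMeasurable φ ν) (hh : AEMeasurable h μ)
    (H : ∀ r : ℝ≥0∞, r ≠ ∞ → ∫⁻ x, φ x - r ∂ν ≤ ∫⁻ x, h x - r ∂μ)
    {τ : ℝ} (hτ : τ ∈ Ioc (0 : ℝ) 1) :
    ∫⁻ s in Ioo 0 τ, rearr ν φ s ≤ ∫⁻ s in Ioo 0 τ, rearr μ h s := by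
  have hsub : Ioo 0 τ ⊆ Ioo (0 : ℝ) 1 := Ioo_subset_Ioo_right hτ.2
  -- At this level ∫₀^τ h* = rτ + ∫ (h - r)⁺ exactly, whereas for φ the inequality ≤ holds at every
  -- level.
  set r := rearr μ h τ with hr
  have hge : ∀ s ∈ Ioo 0 τ, r ≤ rearr μ h s := fun s hs => rearr_antitone h hs.2.le
  rcases eq_or_ne r ∞ with htop | hfin
  · have : ∫⁻ s in Ioo 0 τ, rearr μ h s = ∞ := by
      rw [eq_top_iff]
      calc ∞ = ∫⁻ _ in Ioo 0 τ, r := by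
            rw [htop]; simp [ENNReal.top_mul, hτ.1]
        _ ≤ _ := setLIntegral_mono' measurableSet_Ioo hge
    rw [this]; exact le_top
  have hmeas : Measurable fun t : ℝ≥0∞ => t - r := measurable_id.sub_const r
  calc ∫⁻ s in Ioo 0 τ, rearr ν φ s
      ≤ ∫⁻ s in Ioo 0 τ, ((rearr ν φ s - r) + r) := lintegral_mono fun s => le_tsub_add
    _ = (∫⁻ s in Ioo 0 τ, (rearr ν φ s - r)) + ∫⁻ _ in Ioo 0 τ, r :=
        lintegral_add_right _ measurable_const
    _ ≤ (∫⁻ s, (rearr ν φ s - r) ∂unitMeasure) + ∫⁻ _ in Ioo 0 τ, r := by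
        gcongr; exact Measure.restrict_mono hsub le_rfl
    _ ≤ (∫⁻ s, (rearr μ h s - r) ∂unitMeasure) + ∫⁻ _ in Ioo 0 τ, r := by
        rw [lintegral_comp_rearr hφ hmeas, lintegral_comp_rearr hh hmeas]
        gcongr
        exact H r hfin
    _ = (∫⁻ s in Ioo 0 τ, (rearr μ h s - r)) + ∫⁻ _ in Ioo 0 τ, r := by
        congr 1
        rw [unitMeasure, ← lintegral_indicator measurableSet_Ioo,
          ← lintegral_indicator measurableSet_Ioo]
        refine lintegral_congr fun s => ?_
        by_cases h1 : s < τ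
        · simp [indicator, h1, h1.trans_le hτ.2]
        · have : rearr μ h s - r = 0 := tsub_eq_zero_of_le (rearr_antitone h (not_lt.1 h1))
          simp [indicator, this]
    _ = ∫⁻ s in Ioo 0 τ, ((rearr μ h s - r) + r) := (lintegral_add_right _ measurable_const).symm
    _ = ∫⁻ s in Ioo 0 τ, rearr μ h s :=
        setLIntegral_congr_fun measurableSet_Ioo fun s hs => tsub_add_cancel_of_le (hge s hs)

/-- Dilations are bounded with respect to decreasing weights. -/
theorem lintegral_mul_le_of_dilation {w F G : ℝ → ℝ≥0∞} (hw : Antitone w)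
    (H : ∀ t ∈ Ioo (0 : ℝ) (1 / 2), F (2 * t) ≤ G t) :
    ∫⁻ s in Ioo (0 : ℝ) 1, w s * F s ≤ 2 * ∫⁻ s in Ioo (0 : ℝ) 1, w s * G s := by
  -- Substitute s = 2t: the Jacobian gives the factor 2, and w(2t) ≤ w(t).
  have himg : (fun t : ℝ => 2 * t) '' Ioo 0 (1 / 2) = Ioo 0 1 := by
    rw [image_mul_left_Ioo two_pos]; norm_num
  rw [← himg, lintegral_image_eq_lintegral_abs_deriv_mul (f' := fun _ => 2) measurableSet_Ioo
    (fun x _ => by simpa using ((hasDerivAt_id x).const_mul 2).hasDerivWithinAt)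
    (fun x _ y _ h => by simpa using h), himg, ← lintegral_const_mul' _ _ ENNReal.ofNat_ne_top]
  calc _ ≤ ∫⁻ t in Ioo (0 : ℝ) (1 / 2), 2 * (w t * G t) := by
        refine setLIntegral_mono' measurableSet_Ioo fun t ht => ?_
        have h2 : ENNReal.ofReal |2| = 2 := by simp
        rw [h2]
        gcongr
        · exact hw (by linarith [ht.1])
        · exact H t ht
    _ ≤ _ := lintegral_mono_set (Ioo_subset_Ioo_right (by norm_num))

end Rearrangement

/-! ### Norms of the representation -/

section Bar

variable {α : Type*} [MeasurableSpace α] {μ : Measure α} {β : Type*} [MeasurableSpace β]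
  {ν : Measure β}

theorem RINorm.normOn_eq [IsProbabilityMeasure ν] (X : RINorm μ) (f : β → ℝ≥0∞) :
    X.normOn ν f = ⨆ (g : α → ℝ≥0∞) (_ : AEMeasurable g μ) (_ : X.assoc g ≤ 1),
      ∫⁻ s in Ioo (0 : ℝ) 1, rearr μ g s * rearr ν f s := by
  simp only [RINorm.normOn, RINorm.bar, rearr_rearr]

theorem RINorm.lintegral_le_normOn [IsProbabilityMeasure ν] (X : RINorm μ) (f : β → ℝ≥0∞)
    {g : α → ℝ≥0∞} (hg : AEMeasurable g μ) (hX : X.assoc g ≤ 1) :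
    ∫⁻ s in Ioo (0 : ℝ) 1, rearr μ g s * rearr ν f s ≤ X.normOn ν f := by
  rw [X.normOn_eq]
  exact le_iSup_of_le g (le_iSup_of_le hg (le_iSup_of_le hX le_rfl))

theorem RINorm.lintegral_le_bar (X : RINorm μ) (f : ℝ → ℝ≥0∞)
    {g : α → ℝ≥0∞} (hg : AEMeasurable g μ) (hX : X.assoc g ≤ 1) :
    ∫⁻ s in Ioo (0 : ℝ) 1, rearr μ g s * rearr unitMeasure f s ≤ X.bar f :=
  le_iSup_of_le g (le_iSup_of_le hg (le_iSup_of_le hX le_rfl))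

theorem RINorm.normOn_le [IsProbabilityMeasure ν] (X : RINorm μ) {f : β → ℝ≥0∞} {C : ℝ≥0∞}
    (H : ∀ g : α → ℝ≥0∞, AEMeasurable g μ → X.assoc g ≤ 1 →
      ∫⁻ s in Ioo (0 : ℝ) 1, rearr μ g s * rearr ν f s ≤ C) : X.normOn ν f ≤ C := by
  rw [X.normOn_eq]
  exact iSup_le fun g => iSup_le fun hg => iSup_le fun hX => H g hg hX

theorem RINorm.bar_le (X : RINorm μ) {f : ℝ → ℝ≥0∞} {C : ℝ≥0∞}
    (H : ∀ g : α → ℝ≥0∞, AEMeasurable g μ → X.assoc g ≤ 1 →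
      ∫⁻ s in Ioo (0 : ℝ) 1, rearr μ g s * rearr unitMeasure f s ≤ C) : X.bar f ≤ C :=
  iSup_le fun g => iSup_le fun hg => iSup_le fun hX => H g hg hX

theorem RINorm.normOn_mono [IsProbabilityMeasure ν] (X : RINorm μ) {f g : β → ℝ≥0∞}
    (h : ∀ x, f x ≤ g x) : X.normOn ν f ≤ X.normOn ν g :=
  X.normOn_le fun _ hk hX => (lintegral_mono fun s => by gcongr; exact rearr_mono h s).trans
    (X.lintegral_le_normOn g hk hX)

/-- The factor 2 comes from the dilation in `rearr_add_le`. A quasi-triangle inequality suffices,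
since constants play no role. -/
theorem RINorm.normOn_add_le [IsProbabilityMeasure ν] (X : RINorm μ) (f g : β → ℝ≥0∞) :
    X.normOn ν (fun x => f x + g x) ≤ 2 * (X.normOn ν f + X.normOn ν g) := by
  refine X.normOn_le fun k hk hX => ?_
  calc _ ≤ 2 * ∫⁻ s in Ioo (0 : ℝ) 1, rearr μ k s * (rearr ν f s + rearr ν g s) :=
        lintegral_mul_le_of_dilation (rearr_antitone k) fun t ht => rearr_add_le f g ht.1.le
    _ = 2 * ((∫⁻ s in Ioo (0 : ℝ) 1, rearr μ k s * rearr ν f s) +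
          ∫⁻ s in Ioo (0 : ℝ) 1, rearr μ k s * rearr ν g s) := by
        simp_rw [mul_add (rearr μ k _)]
        congr 1
        exact lintegral_add_left ((measurable_rearr k).mul (measurable_rearr f)) _
    _ ≤ _ := by
        gcongr
        · exact X.lintegral_le_normOn f hk hX
        · exact X.lintegral_le_normOn g hk hX

/-- The norm of the representation is monotone for the Hardy-Littlewood-Pólya order. -/
theorem RINorm.bar_le_normOn [IsProbabilityMeasure μ] [IsProbabilityMeasure ν] (X : RINorm μ)
    {φ : ℝ → ℝ≥0∞} {h : β → ℝ≥0∞}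
    (hφ : AEMeasurable φ unitMeasure) (hh : AEMeasurable h ν)
    (H : ∀ r : ℝ≥0∞, r ≠ ∞ → ∫⁻ x, φ x - r ∂unitMeasure ≤ ∫⁻ x, h x - r ∂ν) :
    X.bar φ ≤ X.normOn ν h :=
  X.bar_le fun g hg hX => (lintegral_rearr_mul_le g (measurable_rearr φ) (measurable_rearr h)
    fun _ hτ => lintegral_rearr_le_of_forall_sub hφ hh H hτ).trans (X.lintegral_le_normOn h hg hX)

/-- Hölder's inequality against constants. -/
theorem RINorm.lintegral_le_of_assoc_le_one [IsProbabilityMeasure μ] (X : RINorm μ) :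
    ∃ C : ℝ≥0, ∀ g : α → ℝ≥0∞, X.assoc g ≤ 1 → ∫⁻ x, g x ∂μ ≤ C := by
  have h1 : X.norm (univ.indicator 1) < ∞ :=
    X.norm_indicator_lt_top univ MeasurableSet.univ (measure_lt_top _ _)
  obtain ⟨N, hN⟩ : ∃ N : ℝ≥0, X.norm (univ.indicator 1) = N := ⟨_, (ENNReal.coe_toNNReal h1.ne).symm⟩
  -- Normalising by N + 1 instead of N avoids a division by zero.
  have hpos : 0 < N + 1 := by positivity
  refine ⟨N + 1, fun g hg => ?_⟩
  have hk : X.norm (fun x => ((N + 1)⁻¹ : ℝ≥0) * univ.indicator (1 : α → ℝ≥0∞) x) ≤ 1 := by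
    rw [X.norm_smul _ _ 
      (measurable_one.indicator MeasurableSet.univ).aemeasurable, hN]
    rw [← ENNReal.coe_mul, ← ENNReal.coe_one, ENNReal.coe_le_coe, inv_mul_le_iff₀ hpos]
    simp
  have := le_iSup_of_le (f := fun k : α → ℝ≥0∞ => ⨆ (_ : AEMeasurable k μ) (_ : X.norm k ≤ 1),
    ∫⁻ x, k x * g x ∂μ) (a := ∫⁻ x, ((N + 1)⁻¹ : ℝ≥0) * g x ∂μ)
    (fun x => ((N + 1)⁻¹ : ℝ≥0) * univ.indicator (1 : α → ℝ≥0∞) x)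
    (le_iSup_of_le (by simp) (le_iSup_of_le hk (by simp)))
  have h2 := this.trans hg
  rw [lintegral_const_mul' _ _ ENNReal.coe_ne_top] at h2
  have h3 : ((N + 1 : ℝ≥0) : ℝ≥0∞) * (((N + 1)⁻¹ : ℝ≥0) * ∫⁻ x, g x ∂μ) ≤ (N + 1 : ℝ≥0) * 1 := by
    gcongr
  rwa [← mul_assoc, ← ENNReal.coe_mul, mul_inv_cancel₀ hpos.ne', ENNReal.coe_one, one_mul,
    mul_one] at h3

/-- Dual form of the embedding of X in L¹: testing `bar` against a small constant recovers the
integral. -/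
theorem RINorm.exists_const_assoc_le_one (X : RINorm μ) [IsProbabilityMeasure μ] :
    ∃ ε : ℝ≥0, 0 < ε ∧ X.assoc (fun _ => (ε : ℝ≥0∞)) ≤ 1 := by
  obtain ⟨C, hC⟩ := X.lintegral_le univ MeasurableSet.univ (measure_lt_top _ _)
  have hpos : 0 < C + 1 := by positivity
  refine ⟨(C + 1)⁻¹, by positivity, iSup_le fun g => iSup_le fun hg => iSup_le fun hX => ?_⟩
  rw [lintegral_mul_const' _ _ ENNReal.coe_ne_top]
  have h1 := hC g hg
  rw [Measure.restrict_univ] at h1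
  calc (∫⁻ x, g x ∂μ) * ((C + 1)⁻¹ : ℝ≥0) ≤ (C * 1) * ((C + 1)⁻¹ : ℝ≥0) := by
        gcongr; exact h1.trans (by gcongr)
    _ ≤ 1 := by
        rw [mul_one, ← ENNReal.coe_mul, ← ENNReal.coe_one, ENNReal.coe_le_coe,
          mul_inv_le_iff₀ hpos]
        simp

/-- The spaces `X(Ω₁)` embed in `L¹`. -/
theorem RINorm.exists_lintegral_le_normOn [IsProbabilityMeasure μ] [IsProbabilityMeasure ν]
    (X : RINorm μ) : ∃ C : ℝ≥0, ∀ f : β → ℝ≥0∞, AEMeasurable f ν →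
      ∫⁻ x, f x ∂ν ≤ C * X.normOn ν f := by
  obtain ⟨ε, hε, hX⟩ := X.exists_const_assoc_le_one
  refine ⟨ε⁻¹, fun f hf => ?_⟩
  have h1 := X.lintegral_le_normOn (ν := ν) f aemeasurable_const hX
  have h2 : ∫⁻ s in Ioo (0 : ℝ) 1, rearr μ (fun _ => (ε : ℝ≥0∞)) s * rearr ν f s =
      ε * ∫⁻ x, f x ∂ν := by
    rw [← lintegral_Ioo_rearr hf, ← lintegral_const_mul' _ _ ENNReal.coe_ne_top]
    exact setLIntegral_congr_fun measurableSet_Ioo fun s hs => by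
      simp only [rearr_const _ hs.2]
  rw [h2] at h1
  calc ∫⁻ x, f x ∂ν = ((ε⁻¹ : ℝ≥0) : ℝ≥0∞) * (ε * ∫⁻ x, f x ∂ν) := by
        rw [← mul_assoc, ← ENNReal.coe_mul, inv_mul_cancel₀ hε.ne', ENNReal.coe_one, one_mul]
    _ ≤ _ := by gcongr

/-- Bounded functions lie in X̄, because the unit ball of the associate space is bounded in L¹. -/
theorem RINorm.exists_bar_le (X : RINorm μ) [IsProbabilityMeasure μ] :
    ∃ C : ℝ≥0, ∀ (f : ℝ → ℝ≥0∞) (c : ℝ≥0∞), (∀ s ∈ Ioo (0 : ℝ) 1, rearr unitMeasure f s ≤ c) →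
      X.bar f ≤ C * c := by
  obtain ⟨C, hC⟩ := X.lintegral_le_of_assoc_le_one
  refine ⟨C, fun f c hf => X.bar_le fun g hg hX => ?_⟩
  calc ∫⁻ s in Ioo (0 : ℝ) 1, rearr μ g s * rearr unitMeasure f s
      ≤ ∫⁻ s in Ioo (0 : ℝ) 1, rearr μ g s * c :=
        setLIntegral_mono' measurableSet_Ioo fun s hs => by gcongr; exact hf s hs
    _ = (∫⁻ x, g x ∂μ) * c := by
        rw [lintegral_mul_const _ (measurable_rearr g), lintegral_Ioo_rearr hg]
    _ ≤ C * c := by gcongr; exact hC g hX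

theorem RINorm.exists_normOn_const_le [IsProbabilityMeasure μ] [IsProbabilityMeasure ν]
    (X : RINorm μ) : ∃ C : ℝ≥0, ∀ c : ℝ≥0∞, X.normOn ν (fun _ : β => c) ≤ C * c := by
  obtain ⟨C, hC⟩ := X.exists_bar_le
  exact ⟨C, fun c => hC _ c fun s _ => by rw [rearr_rearr]; exact rearr_const_le c s⟩

end Bar

/-! ### The gradient and the coarea inequality -/

section Coarea

variable {Ω : Type*} [MetricSpace Ω]

theorem LipOnBalls.continuous {f : Ω → ℝ} (hf : LipOnBalls f) : Continuous f :=
  continuous_iff_continuousAt.2 fun x => by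
    obtain ⟨K, hK⟩ := hf x 1
    exact hK.continuousOn.continuousAt (Metric.ball_mem_nhds x one_pos)

/-- The term in ε leaves room for subtracting a small multiple of the distance to a point, which
serves as a cutoff below. -/
theorem LipOnBalls.of_abs_sub_le {f u : Ω → ℝ} (hf : LipOnBalls f) {ε : ℝ} (hε : 0 ≤ ε)
    (h : ∀ x y, |u x - u y| ≤ |f x - f y| + ε * dist x y) : LipOnBalls u := fun x r => by
  obtain ⟨K, hK⟩ := hf x r
  refine ⟨K + ε.toNNReal, LipschitzOnWith.of_dist_le_mul fun y hy z hz => ?_⟩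
  have h1 := hK.dist_le_mul y hy z hz
  rw [Real.dist_eq] at h1 ⊢
  calc |u y - u z| ≤ |f y - f z| + ε * dist y z := h y z
    _ ≤ K * dist y z + ε * dist y z := by gcongr
    _ = _ := by rw [NNReal.coe_add, Real.coe_toNNReal _ hε, add_mul]

theorem gradMod_le_add {f u : Ω → ℝ} {ε : ℝ} (hε : 0 ≤ ε)
    (h : ∀ x y, |u x - u y| ≤ |f x - f y| + ε * dist x y) (x : Ω) :
    gradMod u x ≤ gradMod f x + ENNReal.ofReal ε := by
  refine ENNReal.le_of_forall_pos_le_add fun δ hδ hfin => ?_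
  have hlt : gradMod f x < gradMod f x + δ :=
    ENNReal.lt_add_right (ENNReal.add_lt_top.1 hfin).1.ne (by simpa using hδ.ne')
  refine limsup_le_of_le (by isBoundedDefault) ?_
  filter_upwards [eventually_lt_of_limsup_lt hlt (by isBoundedDefault), self_mem_nhdsWithin]
    with y hy hne
  have hd : 0 < dist x y := dist_pos.2 (Ne.symm hne)
  calc ENNReal.ofReal (|u x - u y| / dist x y)
      ≤ ENNReal.ofReal (|f x - f y| / dist x y + ε) := by
        refine ENNReal.ofReal_le_ofReal ?_
        rw [div_add' _ _ _ hd.ne']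
        gcongr
        exact h x y
    _ = ENNReal.ofReal (|f x - f y| / dist x y) + ENNReal.ofReal ε :=
        ENNReal.ofReal_add (by positivity) hε
    _ ≤ gradMod f x + δ + ENNReal.ofReal ε := by gcongr
    _ = _ := by ring

theorem gradMod_mono {f u : Ω → ℝ} (h : ∀ x y, |u x - u y| ≤ |f x - f y|) (x : Ω) :
    gradMod u x ≤ gradMod f x := by
  simpa using gradMod_le_add le_rfl (by simpa using h) x

theorem exists_abs_sub_le_of_gradMod_lt {f : Ω → ℝ} {x : Ω} {L : ℝ≥0}
    (h : gradMod f x < L) : ∃ δ > 0, ∀ y, dist x y < δ → |f x - f y| ≤ L * dist x y := by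
  have h1 := eventually_lt_of_limsup_lt h (by isBoundedDefault)
  obtain ⟨δ, hδ, hball⟩ := Metric.mem_nhdsWithin_iff.1 h1
  refine ⟨δ, hδ, fun y hy => ?_⟩
  rcases eq_or_ne y x with rfl | hne
  · simp
  have hd : 0 < dist x y := dist_pos.2 (Ne.symm hne)
  have h2 : ENNReal.ofReal (|f x - f y| / dist x y) < L :=
    hball ⟨by rwa [Metric.mem_ball, dist_comm], hne⟩
  rw [ENNReal.ofReal_lt_coe_iff (by positivity), div_lt_iff₀ hd] at h2
  exact h2.le

variable [MeasurableSpace Ω] [BorelSpace Ω]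

/-- For fixed y, the conditions on x defining the supremum over a punctured ball are open, so each
supremum has open superlevel sets even though the union over y may be uncountable. -/
theorem measurable_gradMod {f : Ω → ℝ} (hf : Continuous f) : Measurable (gradMod f) := by
  set q : Ω → Ω → ℝ≥0∞ := fun x y => ENNReal.ofReal (|f x - f y| / dist x y) with hq
  have heq : gradMod f = fun x => ⨅ n : ℕ, ⨆ y ∈ {y | y ≠ x ∧ dist y x < 1 / ((n : ℝ) + 1)},
      q x y := by
    funext x
    have hb : (𝓝[≠] x).HasBasis (fun _ : ℕ => True)
        fun n => {y | y ≠ x ∧ dist y x < 1 / ((n : ℝ) + 1)} := by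
      have := (Metric.nhds_basis_ball_inv_nat_succ (x := x)).inf_principal {x}ᶜ
      refine this.congr (fun _ => Iff.rfl) fun n _ => ?_
      ext y
      simp [and_comm]
    exact hb.limsup_eq_iInf_iSup.trans (by simp [hq])
  rw [heq]
  refine Measurable.iInf fun n => ?_
  refine measurable_of_Ioi fun a => IsOpen.measurableSet ?_
  have hset : (fun x => ⨆ y ∈ {y | y ≠ x ∧ dist y x < 1 / ((n : ℝ) + 1)}, q x y) ⁻¹' Ioi a =
      ⋃ y, {x | y ≠ x ∧ dist y x < 1 / ((n : ℝ) + 1) ∧ a < q x y} := by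
    ext x
    simp only [mem_preimage, mem_Ioi, lt_iSup_iff, mem_iUnion, mem_ofPred_eq, exists_prop, and_assoc]
  rw [hset]
  refine isOpen_iUnion fun y => isOpen_iff_mem_nhds.2 fun x hx => ?_
  obtain ⟨h1, h2, h3⟩ := hx
  have c1 : ∀ᶠ z in 𝓝 x, y ≠ z := by
    filter_upwards [isOpen_ne.mem_nhds (Ne.symm h1)] with z hz using Ne.symm hz
  have c2 : ∀ᶠ z in 𝓝 x, dist y z < 1 / ((n : ℝ) + 1) :=
    (continuous_const.dist continuous_id).continuousAt.eventually (gt_mem_nhds h2)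
  have c3 : ∀ᶠ z in 𝓝 x, a < q z y := by
    refine Tendsto.eventually (f := fun z => q z y) ?_ (lt_mem_nhds h3)
    refine ENNReal.continuous_ofReal.continuousAt.comp ?_
    exact ((hf.sub continuous_const).abs.continuousAt).div
      (continuous_id.dist continuous_const).continuousAt (dist_pos.2 (Ne.symm h1)).ne'
  filter_upwards [c1, c2, c3] with z z1 z2 z3 using ⟨z1, z2, z3⟩

/-- The coarea inequality for bounded uniformly locally Lipschitz functions. -/
theorem lintegral_perimeter_le {μ : Measure Ω} [IsProbabilityMeasure μ] {v : Ω → ℝ} {T : ℝ}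
    {K : ℝ≥0} (h0 : ∀ x, 0 ≤ v x) (hT : ∀ x, v x ≤ T)
    (hK : ∀ x y, dist x y < 1 → |v x - v y| ≤ K * dist x y) :
    ∫⁻ s in Ioi (0 : ℝ), perimeter μ {x | s < v x} ≤ ∫⁻ x, gradMod v x ∂μ := by
  have hcont : Continuous v := continuous_iff_continuousAt.2 fun x => by
    have : LipschitzOnWith K v (Metric.ball x (1 / 2)) :=
      LipschitzOnWith.of_dist_le_mul fun y hy z hz => by
        refine hK y z ?_
        have := dist_triangle_right y z x
        rw [Metric.mem_ball] at hy hz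
        linarith
    exact this.continuousOn.continuousAt (Metric.ball_mem_nhds x (by norm_num))
  set h : ℕ → ℝ := fun n => 1 / ((n : ℝ) + 1) with hh
  have hpos : ∀ n, 0 < h n := fun n => Nat.one_div_pos_of_nat
  have hle1 : ∀ n, h n ≤ 1 := fun n => by
    rw [hh]; simp only; rw [div_le_one (by positivity)]; simp
  have hlim : Tendsto h atTop (𝓝[>] 0) :=
    tendsto_nhdsWithin_iff.2 ⟨tendsto_one_div_add_atTop_nhds_zero_nat, Eventually.of_forall hpos⟩
  -- The superlevel sets of this local supremum are exactly the thickenings of those of v, so the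
  -- layer cake formula turns the integrated Minkowski quotients into ∫ (V - v)/h.
  set V : ℕ → Ω → ℝ := fun n x => ⨆ y : Metric.ball x (h n), v y with hV
  have hbdd : ∀ n (x : Ω), BddAbove (range fun y : Metric.ball x (h n) => v y) := fun n x =>
    ⟨T, by rintro _ ⟨y, rfl⟩; exact hT y⟩
  have hself : ∀ n x, v x ≤ V n x := fun n x =>
    le_ciSup (hbdd n x) ⟨x, Metric.mem_ball_self (hpos n)⟩
  have hVset : ∀ n s, {x | s < V n x} = Metric.thickening (h n) {x | s < v x} := by
    intro n s
    ext x
    have : Nonempty (Metric.ball x (h n)) := ⟨⟨x, Metric.mem_ball_self (hpos n)⟩⟩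
    simp only [mem_ofPred_eq, Metric.mem_thickening_iff, hV, lt_ciSup_iff (hbdd n x), Subtype.exists,
      Metric.mem_ball, exists_prop]
    exact exists_congr fun y => by rw [dist_comm y x, and_comm]
  have hVle : ∀ n x (L : ℝ≥0), (∀ y, dist x y < h n → |v x - v y| ≤ L * dist x y) →
      V n x ≤ v x + L * h n := by
    intro n x L hL
    have : Nonempty (Metric.ball x (h n)) := ⟨⟨x, Metric.mem_ball_self (hpos n)⟩⟩
    refine ciSup_le fun y => ?_
    have hy : dist x y < h n := by rw [dist_comm]; exact y.2
    have h1 := (abs_le.1 (hL y hy)).1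
    have h2 : (L : ℝ) * dist x y ≤ L * h n := by gcongr
    linarith
  have hVmeas : ∀ n, Measurable (V n) := fun n => measurable_of_Ioi fun s => by
    have : V n ⁻¹' Ioi s = {x | s < V n x} := rfl
    rw [this, hVset]
    exact Metric.isOpen_thickening.measurableSet
  set D : ℕ → Ω → ℝ≥0∞ := fun n x =>
    (ENNReal.ofReal (V n x) - ENNReal.ofReal (v x)) / ENNReal.ofReal (h n) with hD
  have hDmeas : ∀ n, Measurable (D n) := fun n =>
    ((hVmeas n).ennreal_ofReal.sub hcont.measurable.ennreal_ofReal).div_const _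
  have hDle : ∀ n x (L : ℝ≥0), (∀ y, dist x y < h n → |v x - v y| ≤ L * dist x y) →
      D n x ≤ L := by
    intro n x L hL
    refine ENNReal.div_le_of_le_mul ?_
    rw [← ENNReal.ofReal_sub _ (h0 x), ← ENNReal.ofReal_coe_nnreal,
      ← ENNReal.ofReal_mul L.coe_nonneg]
    exact ENNReal.ofReal_le_ofReal (by linarith [hVle n x L hL])
  have hint : ∀ n, ∫⁻ s in Ioi (0 : ℝ),
      (μ (Metric.thickening (h n) {x | s < v x}) - μ {x | s < v x}) / ENNReal.ofReal (h n) =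
      ∫⁻ x, D n x ∂μ := by
    intro n
    have hanti : Antitone fun s => μ {x | s < v x} := fun s t hst =>
      measure_mono fun x hx => lt_of_le_of_lt hst hx
    have hfin : ∫⁻ x, ENNReal.ofReal (v x) ∂μ ≠ ∞ := by
      refine ((lintegral_mono fun x => ENNReal.ofReal_le_ofReal (hT x)).trans_lt ?_).ne
      simp
    have e1 := lintegral_eq_lintegral_meas_lt μ (Eventually.of_forall h0)
      hcont.measurable.aemeasurable
    have e2 := lintegral_eq_lintegral_meas_lt μ
      (Eventually.of_forall fun x => (h0 x).trans (hself n x)) (hVmeas n).aemeasurable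
    simp only [hVset] at e2
    simp only [hD, div_eq_mul_inv]
    have hinv : (ENNReal.ofReal (h n))⁻¹ ≠ ∞ := by simpa using hpos n
    rw [lintegral_mul_const' _ _ hinv, lintegral_mul_const' _ _ hinv,
      lintegral_sub' hanti.measurable.aemeasurable (by rwa [← e1])
        (Eventually.of_forall fun s => measure_mono (Metric.self_subset_thickening (hpos n) _)),
      lintegral_sub' hcont.measurable.ennreal_ofReal.aemeasurable hfin
        (Eventually.of_forall fun x => ENNReal.ofReal_le_ofReal (hself n x)), e1, e2]
  have hanti' : ∀ n, Antitone fun s => μ (Metric.thickening (h n) {x | s < v x}) :=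
    fun n s t hst => measure_mono
      (Metric.thickening_subset_of_subset _ fun x hx => lt_of_le_of_lt hst hx)
  have hanti : Antitone fun s => μ {x | s < v x} := fun s t hst =>
    measure_mono fun x hx => lt_of_le_of_lt hst hx
  calc ∫⁻ s in Ioi (0 : ℝ), perimeter μ {x | s < v x}
      ≤ ∫⁻ s in Ioi (0 : ℝ), liminf (fun n =>
          (μ (Metric.thickening (h n) {x | s < v x}) - μ {x | s < v x}) /
            ENNReal.ofReal (h n)) atTop := by
        refine lintegral_mono fun s => ?_
        exact liminf_le_liminf_of_le hlim
    _ ≤ liminf (fun n => ∫⁻ s in Ioi (0 : ℝ),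
          (μ (Metric.thickening (h n) {x | s < v x}) - μ {x | s < v x}) /
            ENNReal.ofReal (h n)) atTop :=
        lintegral_liminf_le fun n => ((hanti' n).measurable.sub hanti.measurable).div_const _
    _ ≤ limsup (fun n => ∫⁻ x, D n x ∂μ) atTop := by
        simp only [hint]
        exact liminf_le_limsup
    -- Reverse Fatou; the uniform Lipschitz constant K is the integrable majorant.
    _ ≤ ∫⁻ x, limsup (fun n => D n x) atTop ∂μ :=
        limsup_lintegral_le (fun _ => (K : ℝ≥0∞)) hDmeas
          (fun n => Eventually.of_forall fun x =>
            hDle n x K fun y hy => hK x y (hy.trans_le (hle1 n))) (by simp)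
    _ ≤ ∫⁻ x, gradMod v x ∂μ := by
        refine lintegral_mono fun x => le_of_forall_gt fun L hL => ?_
        obtain ⟨L', hL', hLL⟩ := ENNReal.lt_iff_exists_nnreal_btwn.1 hL
        obtain ⟨δ, hδ, hbound⟩ := exists_abs_sub_le_of_gradMod_lt hL'
        refine lt_of_le_of_lt (limsup_le_of_le (by isBoundedDefault) ?_) hLL
        have : ∀ᶠ n in atTop, h n < δ :=
          (tendsto_nhdsWithin_iff.1 hlim).1.eventually (gt_mem_nhds hδ)
        filter_upwards [this] with n hn
        exact hDle n x L' fun y hy => hbound y (hy.trans hn)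

end Coarea

/-! ### The gradient between two levels -/

section Band

variable {Ω : Type*} [MetricSpace Ω] [MeasurableSpace Ω] {μ : Measure Ω}

theorem profile_le_perimeter [IsFiniteMeasure μ] {A : Set Ω} (hA : MeasurableSet A) :
    profile μ (μ A).toReal ≤ perimeter μ A :=
  iInf₂_le_of_le A hA (iInf_le _ (ENNReal.ofReal_toReal (measure_ne_top _ _)).symm)

/-- If every level set of `f` between the levels `p < q` has measure in `(a, b]`, and the profile
is at least `κ` there, then `|∇f|` has integral at least `κ (q - p)` over `{p < f < q}`. -/
theorem mul_le_setLIntegral_gradMod (hΩ : MetricProbSpace μ) {f : Ω → ℝ} (hf : LipOnBalls f)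
    {p q : ℝ} (hpq : p ≤ q) {a b κ : ℝ≥0∞} (hκ : κ ≠ ∞)
    (ha : ∀ s ∈ Ioo p q, a < μ {x | s < f x}) (hb : ∀ s ∈ Ioo p q, μ {x | s < f x} ≤ b)
    (hprof : ∀ m, a < m → m ≤ b → κ ≤ profile μ m.toReal) :
    κ * ENNReal.ofReal (q - p) ≤ ∫⁻ x in {x | p < f x ∧ f x < q}, gradMod f x ∂μ := by
  have := hΩ.borel
  have := hΩ.prob
  have := hΩ.connected
  obtain ⟨x₀⟩ : Nonempty Ω := inferInstance
  have hfc := hf.continuous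
  set E : Set Ω := {x | p < f x ∧ f x < q} with hE
  have hEm : MeasurableSet E :=
    ((isOpen_lt continuous_const hfc).inter (isOpen_lt hfc continuous_const)).measurableSet
  set u : Ω → ℝ := fun x => max p (min (f x) q) - p with hu
  have hu0 : ∀ x, 0 ≤ u x := fun x => sub_nonneg.2 (le_max_left _ _)
  have huT : ∀ x, u x ≤ q - p := fun x =>
    sub_le_sub_right (max_le hpq (min_le_right _ _)) _
  have huf : ∀ x y, |u x - u y| ≤ |f x - f y| := by
    intro x y
    have h1 : u x - u y = max (min (f x) q) p - max (min (f y) q) p := by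
      simp only [hu, max_comm p]; ring
    rw [h1]
    refine (abs_max_sub_max_le_abs _ _ _).trans ((abs_min_sub_min_le_max _ _ _ _).trans ?_)
    simp
  have hulip : LipOnBalls u := hf.of_abs_sub_le le_rfl (by simpa using huf)
  have hlevel : ∀ s ∈ Ioo 0 (q - p), {x | s < u x} = {x | p + s < f x} := by
    intro s hs
    ext x
    have h1 : p + s < q := by linarith [hs.2]
    simp only [hu, mem_ofPred_eq, lt_sub_iff_add_lt', lt_max_iff, lt_min_iff, h1, and_true]
    exact ⟨fun h => h.resolve_left (by linarith [hs.1]), Or.inr⟩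
  -- u is Lipschitz only on balls. Subtracting ε times a distance and truncating at 0 makes it
  -- vanish off a ball, hence uniformly Lipschitz at unit scale, as the coarea inequality requires.
  set v : ℝ → Ω → ℝ := fun ε x => max 0 (u x - ε * dist x x₀) with hv
  have hvu : ∀ ε, 0 ≤ ε → ∀ x, v ε x ≤ u x := fun ε hε x =>
    max_le (hu0 x) (sub_le_self _ (by positivity))
  have hvlip : ∀ ε, 0 ≤ ε → ∀ x y, |v ε x - v ε y| ≤ |u x - u y| + ε * dist x y := by
    intro ε hε x y
    have h1 : v ε x - v ε y = max (u x - ε * dist x x₀) 0 - max (u y - ε * dist y x₀) 0 := by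
      simp only [hv, max_comm (0 : ℝ)]
    rw [h1]
    refine (abs_max_sub_max_le_abs _ _ _).trans ?_
    have h2 : u x - ε * dist x x₀ - (u y - ε * dist y x₀) =
      (u x - u y) - ε * (dist x x₀ - dist y x₀) := by ring
    rw [h2]
    refine (abs_sub _ _).trans ?_
    rw [abs_mul, abs_of_nonneg hε]
    gcongr
    exact abs_dist_sub_le x y x₀
  -- Off the band u takes one of the values 0 and q - p, and its gradient vanishes a.e. on those two
  -- level sets.
  have hgrad : ∀ᵐ x ∂μ, ∀ ε, 0 ≤ ε →
      gradMod (v ε) x ≤ E.indicator (gradMod f) x + ENNReal.ofReal ε := by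
    filter_upwards [hΩ.gradMod_level u hulip 0, hΩ.gradMod_level u hulip (q - p)] with x h0 hT ε hε
    refine (gradMod_le_add hε (hvlip ε hε) x).trans ?_
    gcongr
    by_cases hx : x ∈ E
    · rw [indicator_of_mem hx]
      exact gradMod_mono huf x
    · have hx' : u x = 0 ∨ u x = q - p := by
        simp only [hE, mem_ofPred_eq, not_and_or, not_lt] at hx
        rcases hx with hx | hx
        · left; simp [hu, min_le_of_left_le hx]
        · right; simp [hu, hx, hpq]
      rcases hx' with hx' | hx'
      · rw [h0 hx']; exact zero_le
      · rw [hT hx']; exact zero_le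
  -- The cutoff shrinks superlevel sets, so the lower bound a may fail at some levels. The good
  -- levels exhaust (0, q - p) as ε → 0.
  set G : ℝ → Set ℝ := fun ε => {s | s ∈ Ioo 0 (q - p) ∧ a < μ {x | s < v ε x}} with hG
  have hanti : ∀ w : Ω → ℝ, Antitone fun s => μ {x | s < w x} := fun w s t hst =>
    measure_mono fun x hx => lt_of_le_of_lt hst hx
  have key : ∀ ε, 0 < ε → κ * volume (G ε) ≤ ∫⁻ x in E, gradMod f x ∂μ + ENNReal.ofReal ε := by
    intro ε hε
    have hGm : MeasurableSet (G ε) := measurableSet_Ioo.inter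
      (measurableSet_lt measurable_const (hanti (v ε)).measurable)
    have hvc : Continuous (v ε) := (hulip.of_abs_sub_le hε.le (hvlip ε hε.le)).continuous
    -- With the margin 2, two points at distance less than 1 either both lie in this ball or both
    -- lie where the cutoff function vanishes.
    obtain ⟨K, hK⟩ := hulip x₀ ((q - p) / ε + 2)
    have hvK : ∀ x y, dist x y < 1 → |v ε x - v ε y| ≤ (K + ε.toNNReal : ℝ≥0) * dist x y := by
      intro x y hxy
      by_cases hx : dist x x₀ < (q - p) / ε + 1
      · have hy : dist y x₀ < (q - p) / ε + 2 := by
          have := dist_triangle_left y x₀ x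
          linarith
        have h1 := hK.dist_le_mul x (by rw [Metric.mem_ball]; linarith) y hy
        rw [Real.dist_eq] at h1
        refine (hvlip ε hε.le x y).trans ?_
        rw [NNReal.coe_add, Real.coe_toNNReal _ hε.le, add_mul]
        gcongr
      · have hzero : ∀ z, (q - p) / ε ≤ dist z x₀ → v ε z = 0 := by
          intro z hz
          rw [div_le_iff₀' hε] at hz
          exact max_eq_left (by linarith [huT z])
        have hy := dist_triangle x y x₀
        rw [hzero x (by linarith), hzero y (by linarith)]
        simpa using by positivity
    calc κ * volume (G ε) = ∫⁻ s in Ioi (0 : ℝ), (G ε).indicator (fun _ => κ) s := by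
          rw [lintegral_indicator_const hGm, Measure.restrict_apply hGm, inter_eq_left.2]
          exact fun s hs => hs.1.1
      _ ≤ ∫⁻ s in Ioi (0 : ℝ), perimeter μ {x | s < v ε x} := by
          refine lintegral_mono fun s => indicator_le
            (f := fun _ => κ) (g := fun s => perimeter μ {x | s < v ε x}) (fun s hs => ?_) s
          refine (hprof _ hs.2 ?_).trans
            (profile_le_perimeter (isOpen_lt continuous_const hvc).measurableSet)
          refine le_trans (measure_mono fun x hx => ?_) (hb (p + s) ⟨?_, ?_⟩)
          · rw [← hlevel s hs.1]
            exact lt_of_lt_of_le hx (hvu ε hε.le x)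
          · linarith [hs.1.1]
          · linarith [hs.1.2]
      _ ≤ ∫⁻ x, gradMod (v ε) x ∂μ :=
          lintegral_perimeter_le (fun x => le_max_left _ _)
            (fun x => (hvu ε hε.le x).trans (huT x)) hvK
      _ ≤ ∫⁻ x, (E.indicator (gradMod f) x + ENNReal.ofReal ε) ∂μ := by
          refine lintegral_mono_ae ?_
          filter_upwards [hgrad] with x hx using hx ε hε.le
      _ = ∫⁻ x in E, gradMod f x ∂μ + ENNReal.ofReal ε := by
          rw [lintegral_add_right _ measurable_const, lintegral_indicator hEm]
          simp
  set ε : ℕ → ℝ := fun n => 1 / ((n : ℝ) + 1) with hε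
  have hεpos : ∀ n, 0 < ε n := fun n => Nat.one_div_pos_of_nat
  have hεanti : Antitone ε := fun n m hnm => Nat.one_div_le_one_div hnm
  have hεlim : Tendsto ε atTop (𝓝 0) := tendsto_one_div_add_atTop_nhds_zero_nat
  have hvmono : ∀ x, Monotone fun n => v (ε n) x := fun x n m hnm => by
    have := hεanti hnm
    simp only [hv]
    gcongr
  have hGmono : Monotone fun n => G (ε n) := fun n m hnm s hs =>
    ⟨hs.1, hs.2.trans_le (measure_mono fun x hx => lt_of_lt_of_le hx (hvmono x hnm))⟩
  have hGU : ⋃ n, G (ε n) = Ioo 0 (q - p) := by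
    refine subset_antisymm (iUnion_subset fun n s hs => hs.1) fun s hs => ?_
    have hU : {x | p + s < f x} = ⋃ n, {x | s < v (ε n) x} := by
      rw [← hlevel s hs]
      refine subset_antisymm (fun x hx => ?_) (iUnion_subset fun n x hx =>
        lt_of_lt_of_le hx (hvu _ (hεpos n).le x))
      have hl : Tendsto (fun n => u x - ε n * dist x x₀) atTop (𝓝 (u x)) := by
        simpa using tendsto_const_nhds.sub (hεlim.mul_const (dist x x₀))
      obtain ⟨n, hn⟩ := (hl.eventually (lt_mem_nhds hx)).exists
      exact mem_iUnion.2 ⟨n, lt_max_of_lt_right hn⟩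
    have h1 := ha (p + s) ⟨by linarith [hs.1], by linarith [hs.2]⟩
    have hmono : Monotone fun n => {x | s < v (ε n) x} := fun n m hnm x hx =>
      lt_of_lt_of_le hx (hvmono x hnm)
    rw [hU, hmono.measure_iUnion, lt_iSup_iff] at h1
    obtain ⟨n, hn⟩ := h1
    exact mem_iUnion.2 ⟨n, hs, hn⟩
  have hlim1 : Tendsto (fun n => κ * volume (G (ε n))) atTop (𝓝 (κ * ENNReal.ofReal (q - p))) := by
    have h1 := tendsto_measure_iUnion_atTop (μ := (volume : Measure ℝ)) hGmono
    rw [hGU, Real.volume_Ioo, sub_zero] at h1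
    exact ENNReal.Tendsto.const_mul h1 (Or.inr hκ)
  have hlim2 : Tendsto (fun n => ∫⁻ x in E, gradMod f x ∂μ + ENNReal.ofReal (ε n)) atTop
      (𝓝 (∫⁻ x in E, gradMod f x ∂μ)) := by
    simpa using tendsto_const_nhds.add (ENNReal.tendsto_ofReal hεlim)
  exact le_of_tendsto_of_tendsto' hlim1 hlim2 fun n => key _ (hεpos n)

end Band

/-! ### Shape of the profile -/

section Shape

variable {I : ℝ → ℝ≥0∞}

theorem ProfileShape.mono (hI : ProfileShape I) {s t : ℝ} (hs : 0 < s) (hst : s ≤ t)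
    (ht : t ≤ 1 / 2) : I s ≤ I t := by
  rcases hst.eq_or_lt with rfl | hst
  · exact le_rfl
  rcases ht.lt_or_eq with ht | rfl
  · exact hI.monotoneOn ⟨hs, hst.trans ht⟩ ⟨hs.trans hst, ht⟩ hst.le
  · have hc : ContinuousAt I (1 / 2) :=
      hI.continuousOn.continuousAt (Icc_mem_nhds (by norm_num) (by norm_num))
    have hl : Tendsto I (𝓝[<] (1 / 2)) (𝓝 (I (1 / 2))) := hc.tendsto.mono_left nhdsWithin_le_nhds
    refine ge_of_tendsto hl ?_
    filter_upwards [Ioo_mem_nhdsLT hst] with r hr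
    exact hI.monotoneOn ⟨hs, hst⟩ ⟨hs.trans hr.1, hr.2⟩ hr.1.le

/-- Concavity on the segment from 0, where I vanishes. -/
theorem ProfileShape.mul_le (hI : ProfileShape I) {l t : ℝ} (hl : l ∈ Icc (0 : ℝ) 1)
    (ht : t ∈ Icc (0 : ℝ) 1) : ENNReal.ofReal l * I t ≤ I (l * t) := by
  have hlt : l * t ∈ Icc (0 : ℝ) 1 :=
    ⟨mul_nonneg hl.1 ht.1, mul_le_one₀ hl.2 ht.1 ht.2⟩
  have h1 := hI.concaveOn.2 (left_mem_Icc.2 zero_le_one) ht (sub_nonneg.2 hl.2) hl.1 (by ring)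
  simp only [hI.zero, smul_eq_mul, mul_zero, zero_add, ENNReal.toReal_zero] at h1
  rw [← ENNReal.toReal_le_toReal (ENNReal.mul_ne_top ENNReal.ofReal_ne_top (hI.ne_top t ht))
    (hI.ne_top _ hlt), ENNReal.toReal_mul, ENNReal.toReal_ofReal hl.1]
  exact h1

theorem ProfileShape.le_two_mul (hI : ProfileShape I) {t : ℝ} (ht : t ∈ Icc (0 : ℝ) 1) :
    I t ≤ 2 * I (t / 2) := by
  have h1 := hI.mul_le (l := 1 / 2) ⟨by norm_num, by norm_num⟩ ht
  rw [one_div_mul_eq_div] at h1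
  calc I t = 2 * (ENNReal.ofReal (1 / 2) * I t) := by
        rw [← mul_assoc, ← ENNReal.ofReal_ofNat 2, ← ENNReal.ofReal_mul two_pos.le]; simp
    _ ≤ _ := by gcongr

end Shape

/-! ### The Hardy operator -/

section Hardy

theorem hardyOp_antitone (I f : ℝ → ℝ≥0∞) : Antitone (hardyOp I f) := fun _ _ hst =>
  lintegral_mono_set (Ioo_subset_Ioo_left hst)

/-- An antitone function may differ from its rearrangement at jumps; the strict inequality s < t
absorbs this. -/
theorem le_rearr_of_antitone {F : ℝ → ℝ≥0∞} (hF : Antitone F) {s t : ℝ} (ht0 : 0 < t)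
    (hst : s < t) (ht : t ≤ 1) : F t ≤ rearr unitMeasure F s := by
  refine le_of_forall_lt fun x hx => lt_rearr_iff.2 ?_
  calc ENNReal.ofReal s < ENNReal.ofReal t := (ENNReal.ofReal_lt_ofReal_iff ht0).2 hst
    _ = unitMeasure (Ioo 0 t) := by
        rw [unitMeasure, Measure.restrict_apply measurableSet_Ioo,
          inter_eq_left.2 (Ioo_subset_Ioo_right ht)]
        simp
    _ ≤ _ := measure_mono fun r hr => lt_of_lt_of_le hx (hF hr.2.le)

variable {α : Type*} [MeasurableSpace α] {μ : Measure α}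

/-- A zero of I in (0,1/2] would spread, by monotonicity and concavity, to a whole interval. There
1/I = ∞, so Q_I would send a bounded indicator to a function of infinite norm. -/
theorem HardyBounded.ne_zero [IsProbabilityMeasure μ] {X Y : RINorm μ} {I : ℝ → ℝ≥0∞}
    (hI : ProfileShape I) (h : HardyBounded I X.bar Y.bar) {t : ℝ} (ht : t ∈ Ioc (0 : ℝ) (1 / 2)) :
    I t ≠ 0 := by
  intro h0
  obtain ⟨c, -, hc⟩ := h
  -- Halving keeps r ≤ 1/4, so (r, 1/2) contains (1/3, 1/2) even when t = 1/2.
  set r := t / 2 with hr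
  have hr0 : 0 < r := by rw [hr]; linarith [ht.1]
  have hr4 : r ≤ 1 / 4 := by rw [hr]; linarith [ht.2]
  have hIr : I r = 0 := le_antisymm
    ((hI.mono hr0 (by rw [hr]; linarith [ht.1]) ht.2).trans h0.le) zero_le
  have hIs : ∀ s ∈ Ioo r (1 / 2), I s = 0 := by
    intro s hs
    have hs0 : 0 < s := hr0.trans hs.1
    have h1 := hI.mul_le (l := r / s) (t := s) ⟨by positivity, (div_le_one hs0).2 hs.1.le⟩
      ⟨hs0.le, by linarith [hs.2]⟩
    rw [div_mul_cancel₀ _ hs0.ne', hIr, nonpos_iff_eq_zero, mul_eq_zero] at h1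
    exact h1.resolve_left (by simpa using div_pos hr0 hs0)
  set f : ℝ → ℝ≥0∞ := (Ioo r (1 / 2)).indicator 1 with hf
  obtain ⟨C, hC⟩ := X.exists_bar_le
  have hfin : X.bar f < ∞ := by
    refine (hC f 1 fun s _ => ?_).trans_lt (by simp)
    rw [rearr_le_iff]
    have : {x | 1 < f x} = ∅ := by
      ext x
      simp [hf, indicator_apply]
      split_ifs <;> simp
    simp [this]
  have h1 := hc f (measurable_one.indicator measurableSet_Ioo).aemeasurable
    (fun s hs => indicator_of_notMem (fun hs' => hs ⟨hr0.trans hs'.1, hs'.2⟩) _) hfin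
  have hQ : hardyOp I f (1 / 3) = ∞ := by
    rw [eq_top_iff]
    calc ∞ = ∫⁻ _ in Ioo (1 / 3 : ℝ) (1 / 2), ∞ := by
          simp; norm_num
      _ ≤ ∫⁻ s in Ioo (1 / 3 : ℝ) (1 / 2), f s / I s := by
          refine setLIntegral_mono' measurableSet_Ioo fun s hs => ?_
          have hs' : s ∈ Ioo r (1 / 2) := ⟨by linarith [hs.1], hs.2⟩
          rw [hIs s hs', hf, indicator_of_mem hs', Pi.one_apply, ENNReal.div_zero one_ne_zero]
      _ ≤ _ := lintegral_mono_set (Ioo_subset_Ioo_right (by norm_num))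
  obtain ⟨ε, hε, hεY⟩ := Y.exists_const_assoc_le_one
  have h2 : Y.bar (hardyOp I f) = ∞ := by
    rw [eq_top_iff]
    refine le_trans ?_ (Y.lintegral_le_bar (hardyOp I f) aemeasurable_const hεY)
    calc ∞ = ∫⁻ _ in Ioo (0 : ℝ) (1 / 3), ∞ := by
          simp [ENNReal.top_mul]
      _ ≤ ∫⁻ s in Ioo (0 : ℝ) (1 / 3),
            rearr μ (fun _ => (ε : ℝ≥0∞)) s * rearr unitMeasure (hardyOp I f) s := by
          refine setLIntegral_mono' measurableSet_Ioo fun s hs => ?_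
          have h3 := le_rearr_of_antitone (hardyOp_antitone I f) (by norm_num) hs.2 (by norm_num)
          rw [hQ, top_le_iff] at h3
          rw [h3, rearr_const _ (by linarith [hs.2]), ENNReal.mul_top (by simpa using hε.ne')]
      _ ≤ _ := lintegral_mono_set (Ioo_subset_Ioo_right (by norm_num))
  rw [h2, top_le_iff] at h1
  exact ENNReal.mul_ne_top ENNReal.ofReal_ne_top hfin.ne h1

end Hardy

/-! ### Transference -/

section Transfer

theorem rearr_ne_top {α : Type*} [MeasurableSpace α] {μ : Measure α} [IsFiniteMeasure μ]
    {f : α → ℝ≥0∞} (hf : Measurable f) (hfin : ∀ x, f x ≠ ∞) {s : ℝ} (hs : 0 < s) :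
    rearr μ f s ≠ ∞ := by
  have hanti : Antitone fun n : ℕ => {x | (n : ℝ≥0∞) < f x} :=
    fun n m hnm x (hx : (m : ℝ≥0∞) < f x) => lt_of_le_of_lt (Nat.cast_le.2 hnm) hx
  have hlim := tendsto_measure_iInter_atTop (μ := μ)
    (fun n : ℕ => (measurableSet_lt measurable_const hf).nullMeasurableSet) hanti
    ⟨0, measure_ne_top _ _⟩
  have hempty : ⋂ n : ℕ, {x | (n : ℝ≥0∞) < f x} = ∅ := by
    refine eq_empty_of_forall_notMem fun x hx => ?_
    obtain ⟨n, hn⟩ := ENNReal.exists_nat_gt (hfin x)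
    exact lt_asymm hn (mem_iInter.1 hx n)
  rw [hempty, measure_empty] at hlim
  obtain ⟨n, hn⟩ := (hlim.eventually (gt_mem_nhds (ENNReal.ofReal_pos.2 hs))).exists
  exact ((rearr_le_iff.2 hn.le).trans_lt (ENNReal.natCast_lt_top n)).ne

theorem exists_median {α : Type*} [MeasurableSpace α] {μ : Measure α} [IsProbabilityMeasure μ]
    {g : α → ℝ} (hg : Measurable g) :
    ∃ m : ℝ, μ {x | m < g x} ≤ ENNReal.ofReal (1 / 2) ∧
      μ {x | g x < m} ≤ ENNReal.ofReal (1 / 2) := by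
  have hhalf : (0 : ℝ≥0∞) < ENNReal.ofReal (1 / 2) := by simp
  have hupper : ∃ t : ℝ, μ {x | t < g x} ≤ ENNReal.ofReal (1 / 2) := by
    have hlim := tendsto_measure_iInter_atTop (μ := μ) (s := fun n : ℕ => {x | (n : ℝ) < g x})
      (fun n => (measurableSet_lt measurable_const hg).nullMeasurableSet)
      (fun n m hnm x (hx : (m : ℝ) < g x) => lt_of_le_of_lt (Nat.cast_le.2 hnm) hx) ⟨0, measure_ne_top _ _⟩
    have hempty : ⋂ n : ℕ, {x | (n : ℝ) < g x} = ∅ := by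
      refine eq_empty_of_forall_notMem fun x hx => ?_
      obtain ⟨n, hn⟩ := exists_nat_gt (g x)
      exact lt_asymm hn (mem_iInter.1 hx n)
    rw [hempty, measure_empty] at hlim
    obtain ⟨n, hn⟩ := (hlim.eventually (gt_mem_nhds hhalf)).exists
    exact ⟨n, hn.le⟩
  have hlower : ∃ t : ℝ, μ {x | g x ≤ t} < ENNReal.ofReal (1 / 2) := by
    have hlim := tendsto_measure_iInter_atTop (μ := μ) (s := fun n : ℕ => {x | g x ≤ -(n : ℝ)})
      (fun n => (measurableSet_le hg measurable_const).nullMeasurableSet)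
      (fun n m hnm x (hx : g x ≤ -(m : ℝ)) => hx.trans (neg_le_neg (Nat.cast_le.2 hnm)))
      ⟨0, measure_ne_top _ _⟩
    have hempty : ⋂ n : ℕ, {x | g x ≤ -(n : ℝ)} = ∅ := by
      refine eq_empty_of_forall_notMem fun x hx => ?_
      obtain ⟨n, hn⟩ := exists_nat_gt (-g x)
      have : g x ≤ -(n : ℝ) := mem_iInter.1 hx n
      linarith
    rw [hempty, measure_empty] at hlim
    obtain ⟨n, hn⟩ := (hlim.eventually (gt_mem_nhds hhalf)).exists
    exact ⟨_, hn⟩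
  have hcompl : ∀ t : ℝ, μ {x | t < g x} ≤ ENNReal.ofReal (1 / 2) ↔
      ENNReal.ofReal (1 / 2) ≤ μ {x | g x ≤ t} := by
    intro t
    have h1 : {x | t < g x} = {x | g x ≤ t}ᶜ := by ext x; simp
    have h2 : (1 : ℝ≥0∞) = ENNReal.ofReal (1 / 2) + ENNReal.ofReal (1 / 2) := by
      rw [← ENNReal.ofReal_add (by norm_num) (by norm_num)]; norm_num
    rw [h1, prob_compl_eq_one_sub (measurableSet_le hg measurable_const), tsub_le_iff_right, h2]
    exact ENNReal.add_le_add_iff_left ENNReal.ofReal_ne_top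
  set S : Set ℝ := {t | μ {x | t < g x} ≤ ENNReal.ofReal (1 / 2)} with hS
  have hbdd : BddBelow S := by
    obtain ⟨t₀, ht₀⟩ := hlower
    refine ⟨t₀, fun t ht => ?_⟩
    by_contra hlt
    have h1 := (hcompl t).1 ht
    exact (not_lt.2 h1) ((measure_mono fun x (hx : g x ≤ t) => hx.trans (not_le.1 hlt).le).trans_lt
      ht₀)
  refine ⟨sInf S, ?_, ?_⟩
  · obtain ⟨u, hu, hlim, hmem⟩ := exists_seq_tendsto_sInf hupper hbdd
    have hU : {x | sInf S < g x} ⊆ ⋃ n, {x | u n < g x} := fun x hx => by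
      obtain ⟨n, hn⟩ := (hlim.eventually (gt_mem_nhds hx)).exists
      exact mem_iUnion.2 ⟨n, hn⟩
    refine (measure_mono hU).trans ?_
    have hmono : Monotone fun n => {x | u n < g x} := fun n m hnm x hx =>
      lt_of_le_of_lt (hu hnm) hx
    rw [hmono.measure_iUnion]
    exact iSup_le hmem
  · obtain ⟨u, hu, hlt, hlim⟩ := exists_seq_strictMono_tendsto (sInf S)
    have hU : {x | g x < sInf S} ⊆ ⋃ n, {x | g x ≤ u n} := fun x hx => by
      obtain ⟨n, hn⟩ := (hlim.eventually (lt_mem_nhds hx)).exists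
      exact mem_iUnion.2 ⟨n, hn.le⟩
    have hmono : Monotone fun n => {x | g x ≤ u n} := fun n m hnm x hx =>
      le_trans hx (hu.monotone hnm)
    refine (measure_mono hU).trans ?_
    rw [hmono.measure_iUnion]
    refine iSup_le fun n => ?_
    by_contra hcon
    exact notMem_of_lt_csInf (hlt n) hbdd ((hcompl _).2 (not_le.1 hcon).le)

variable {Ω : Type*} [MetricSpace Ω] [MeasurableSpace Ω] {μ : Measure Ω}
  {Ω₁ : Type*} [MetricSpace Ω₁] [MeasurableSpace Ω₁] {μ₁ : Measure Ω₁}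

/-- The average of `h` over the sets `E k` is transplanted to the intervals `J k`. -/
theorem lintegral_transplant_sub_le {β : Type*} [MeasurableSpace β] {ν : Measure β}
    {J : ℕ → Set ℝ} {E : ℕ → Set β} {w : ℕ → ℝ≥0∞} {h : β → ℝ≥0∞} {φ : ℝ → ℝ≥0∞}
    (hJm : ∀ k, MeasurableSet (J k)) (hJd : Pairwise (Function.onFun Disjoint J))
    (hJ : ∀ k, unitMeasure (J k) = w k) (hw : ∀ k, w k ≠ 0) (hwt : ∀ k, w k ≠ ∞)
    (hEm : ∀ k, MeasurableSet (E k)) (hEd : Pairwise (Function.onFun Disjoint E))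
    (hE : ∀ k, ν (E k) ≤ w k)
    (hφ : ∀ k, ∀ s ∈ J k, φ s = (∫⁻ x in E k, h x ∂ν) / w k)
    (hφ0 : ∀ s, s ∉ ⋃ k, J k → φ s = 0) (r : ℝ≥0∞) :
    ∫⁻ s, φ s - r ∂unitMeasure ≤ ∫⁻ x, h x - r ∂ν := by
  calc ∫⁻ s, φ s - r ∂unitMeasure
      = ∫⁻ s in ⋃ k, J k, φ s - r ∂unitMeasure := by
        rw [← lintegral_indicator (MeasurableSet.iUnion hJm)]
        refine lintegral_congr fun s => ?_
        by_cases hs : s ∈ ⋃ k, J k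
        · rw [indicator_of_mem hs]
        · rw [indicator_of_notMem hs, hφ0 s hs, zero_tsub]
    _ = ∑' k, ∫⁻ s in J k, φ s - r ∂unitMeasure := lintegral_iUnion hJm hJd _
    _ ≤ ∑' k, ∫⁻ x in E k, h x - r ∂ν := by
        refine ENNReal.tsum_le_tsum fun k => ?_
        calc ∫⁻ s in J k, φ s - r ∂unitMeasure
            = ∫⁻ _ in J k, (∫⁻ x in E k, h x ∂ν) / w k - r ∂unitMeasure :=
              setLIntegral_congr_fun (hJm k) fun s hs => by rw [hφ k s hs]
          _ = (∫⁻ x in E k, h x ∂ν) - r * w k := by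
              rw [setLIntegral_const, hJ, ENNReal.sub_mul fun _ _ => hwt k,
                ENNReal.div_mul_cancel (hw k) (hwt k)]
          -- Jensen's inequality for the convex function (· - r)⁺; `hE` lets the average be taken
          -- with the weight `w k` in place of the measure of `E k`.
          _ ≤ ∫⁻ x in E k, h x - r ∂ν := by
              rw [tsub_le_iff_right]
              calc ∫⁻ x in E k, h x ∂ν ≤ ∫⁻ x in E k, ((h x - r) + r) ∂ν :=
                    lintegral_mono fun x => le_tsub_add
                _ = ∫⁻ x in E k, h x - r ∂ν + r * ν (E k) := by
                    rw [lintegral_add_right _ measurable_const, setLIntegral_const]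
                _ ≤ _ := by gcongr; exact hE k
    _ = ∫⁻ x in ⋃ k, E k, h x - r ∂ν := (lintegral_iUnion hEm hEd _).symm
    _ ≤ _ := setLIntegral_le_lintegral _ _

/-- The set between two values of the rearrangement of a function is small. -/
theorem measure_lt_lt_le {α : Type*} [MeasurableSpace α] {ν : Measure α} [IsFiniteMeasure ν]
    {f : α → ℝ} (hf : Measurable f) {p q : ℝ} {a b : ℝ≥0∞} (ha : a ≠ ∞)
    (hb : ν {x | p < f x} ≤ a + b) (hq : ∀ s ∈ Ioo p q, a ≤ ν {x | s < f x}) :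
    ν {x | p < f x ∧ f x < q} ≤ b := by
  rcases le_or_gt q p with hpq | hpq
  · have : {x | p < f x ∧ f x < q} = ∅ :=
      eq_empty_of_forall_notMem fun x hx => (hx.1.trans hx.2).not_ge hpq
    simp [this]
  -- The bound a holds only at levels strictly below q, since f may have a plateau at q; hence the
  -- approach from below.
  obtain ⟨u, hu, hmem, hlim⟩ := exists_seq_strictMono_tendsto' hpq
  have hU : {x | p < f x ∧ f x < q} ⊆ ⋃ n, {x | p < f x ∧ f x ≤ u n} := fun x hx => by
    obtain ⟨n, hn⟩ := (hlim.eventually (lt_mem_nhds hx.2)).exists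
    exact mem_iUnion.2 ⟨n, hx.1, hn.le⟩
  have hmono : Monotone fun n => {x | p < f x ∧ f x ≤ u n} := fun n m hnm x hx =>
    ⟨hx.1, hx.2.trans (hu.monotone hnm)⟩
  refine (measure_mono hU).trans ?_
  rw [hmono.measure_iUnion]
  refine iSup_le fun n => ?_
  rw [← ENNReal.add_le_add_iff_left ha]
  calc a + ν {x | p < f x ∧ f x ≤ u n} ≤ ν {x | u n < f x} + ν {x | p < f x ∧ f x ≤ u n} := by
        gcongr; exact hq _ (hmem n)
    _ = ν ({x | u n < f x} ∪ {x | p < f x ∧ f x ≤ u n}) := by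
        refine (measure_union' (disjoint_left.2 fun x hx hx' => ?_)
          (measurableSet_lt measurable_const hf)).symm
        exact not_le.2 hx hx'.2
    _ ≤ ν {x | p < f x} := by
        refine measure_mono (union_subset (fun x hx => ?_) fun x hx => hx.1)
        exact (hmem n).1.trans hx
    _ ≤ a + b := hb

/-- The transference of the Poincaré inequality for functions vanishing on half of the space. -/
theorem exists_normOn_le_gradMod (hΩ : MetricProbSpace μ) (hΩ₁ : MetricProbSpace μ₁)
    {X Y : RINorm μ} (hardy : HardyBounded (profile μ) X.bar Y.bar)
    (hprofile : ∃ c : ℝ, 0 < c ∧ ∀ t ∈ Ioc (0 : ℝ) (1 / 2),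
      ENNReal.ofReal c * profile μ t ≤ profile μ₁ t) :
    ∃ C : ℝ≥0, ∀ f : Ω₁ → ℝ, LipOnBalls f → μ₁ {x | 0 < f x} ≤ ENNReal.ofReal (1 / 2) →
      X.normOn μ₁ (gradMod f) < ∞ →
      Y.normOn μ₁ (fun x => ENNReal.ofReal (f x)) ≤ C * X.normOn μ₁ (gradMod f) := by
  have := hΩ.prob
  have := hΩ₁.prob
  have := hΩ₁.borel
  have hI := hΩ.profile_shape
  have hI0 := fun t => HardyBounded.ne_zero hI hardy (t := t)
  obtain ⟨c₀, -, hc₀⟩ := hardy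
  obtain ⟨c, hc, hprof⟩ := hprofile
  set I := profile μ with hIdef
  -- The half pays for I(b_k) ≤ 2 I(b_{k+1}) in `hstep`.
  set δ : ℝ≥0 := (c / 2).toNNReal with hδ
  have hδ0 : 0 < δ := by simpa [hδ] using hc
  have hδ2 : ENNReal.ofReal c = δ * 2 := by
    rw [hδ, ← ENNReal.ofReal.eq_1, ← ENNReal.ofReal_ofNat 2,
      ← ENNReal.ofReal_mul (by positivity), div_mul_cancel₀ _ two_ne_zero]
  refine ⟨2 * (δ⁻¹ * c₀.toNNReal), fun f hf hhalf hfin => ?_⟩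
  have hfm : Measurable f := hf.continuous.measurable
  set F : Ω₁ → ℝ≥0∞ := fun x => ENNReal.ofReal (f x) with hF
  have hFm : Measurable F := hfm.ennreal_ofReal
  set h := gradMod f with hh
  have hhm : Measurable h := measurable_gradMod hf.continuous
  have hFlt : ∀ s : ℝ, 0 ≤ s → {x | ENNReal.ofReal s < F x} = {x | s < f x} := fun s hs => by
    ext x; simp only [hF, mem_ofPred_eq, ENNReal.ofReal_lt_ofReal_iff_of_nonneg hs]
  -- The sequence starts at 1/2, so that the hypothesis on {f > 0} gives T_0 = 0.
  set b : ℕ → ℝ := fun k => (1 / 2) ^ (k + 1) with hb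
  have hb0 : ∀ k, 0 < b k := fun k => by positivity
  have hbs : ∀ k, b k = b (k + 1) + b (k + 1) := fun k => by simp only [hb]; ring
  have hbanti : Antitone b := antitone_nat_of_succ_le fun k => by linarith [hbs k, hb0 (k + 1)]
  have hbh : ∀ k, b k ≤ 1 / 2 := fun k => (hbanti (zero_le : 0 ≤ k)).trans (by simp [hb])
  have hbmem : ∀ k, b k ∈ Ioc (0 : ℝ) (1 / 2) := fun k => ⟨hb0 k, hbh k⟩
  set T : ℕ → ℝ := fun k => (rearr μ₁ F (b k)).toReal with hT
  have hrT : ∀ k, rearr μ₁ F (b k) = ENNReal.ofReal (T k) := fun k =>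
    (ENNReal.ofReal_toReal (rearr_ne_top hFm (fun x => ENNReal.ofReal_ne_top) (hb0 k))).symm
  have hT0 : ∀ k, 0 ≤ T k := fun k => ENNReal.toReal_nonneg
  have hTmono : Monotone T := fun k l hkl => ENNReal.toReal_mono
    (rearr_ne_top hFm (fun x => ENNReal.ofReal_ne_top) (hb0 l)) (rearr_antitone F (hbanti hkl))
  have hTzero : T 0 = 0 := by
    have : rearr μ₁ F (b 0) ≤ 0 := by
      rw [rearr_le_iff, ← ENNReal.ofReal_zero, hFlt 0 le_rfl]
      simpa [hb] using hhalf
    simp [hT, nonpos_iff_eq_zero.1 this]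
  have hup : ∀ k s, T k ≤ s → μ₁ {x | s < f x} ≤ ENNReal.ofReal (b k) := by
    intro k s hs
    rw [← hFlt s ((hT0 k).trans hs), ← rearr_le_iff, hrT]
    exact ENNReal.ofReal_le_ofReal hs
  have hlow : ∀ k s, 0 ≤ s → s < T k → ENNReal.ofReal (b k) < μ₁ {x | s < f x} := by
    intro k s hs0 hs
    rw [← hFlt s hs0, ← lt_rearr_iff, hrT]
    exact (ENNReal.ofReal_lt_ofReal_iff_of_nonneg hs0).2 hs
  set E : ℕ → Set Ω₁ := fun k => {x | T k < f x ∧ f x < T (k + 1)} with hE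
  have hEm : ∀ k, MeasurableSet (E k) := fun k =>
    (measurableSet_lt measurable_const hfm).inter (measurableSet_lt hfm measurable_const)
  have hEd : Pairwise (Function.onFun Disjoint E) := by
    refine (pairwise_disjoint_on E).2 fun k l hkl => disjoint_left.2 fun x hx hx' => ?_
    exact (hx.2.trans_le (hTmono (Nat.succ_le_of_lt hkl))).not_gt hx'.1
  have hEμ : ∀ k, μ₁ (E k) ≤ ENNReal.ofReal (b (k + 1)) := by
    intro k
    refine measure_lt_lt_le hfm (a := ENNReal.ofReal (b (k + 1))) ENNReal.ofReal_ne_top ?_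
      fun s hs => (hlow _ s ((hT0 k).trans hs.1.le) hs.2).le
    rw [← ENNReal.ofReal_add (hb0 _).le (hb0 _).le, ← hbs]
    exact hup k _ le_rfl
  set A : ℕ → ℝ≥0∞ := fun k => ∫⁻ x in E k, h x ∂μ₁ with hA
  have hband : ∀ k, ENNReal.ofReal c * I (b (k + 1)) * ENNReal.ofReal (T (k + 1) - T k) ≤ A k := by
    intro k
    refine mul_le_setLIntegral_gradMod hΩ₁ hf (hTmono k.le_succ)
      (a := ENNReal.ofReal (b (k + 1))) (b := ENNReal.ofReal (b k))
      (ENNReal.mul_ne_top ENNReal.ofReal_ne_top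
        (hI.ne_top _ ⟨(hb0 _).le, by linarith [hbh (k + 1)]⟩))
      (fun s hs => hlow _ s ((hT0 k).trans hs.1.le) hs.2) (fun s hs => hup k s hs.1.le)
      fun m hm1 hm2 => ?_
    have hmt : m ≠ ∞ := (hm2.trans_lt ENNReal.ofReal_lt_top).ne
    have h1 : b (k + 1) < m.toReal := (ENNReal.ofReal_lt_iff_lt_toReal (hb0 _).le hmt).1 hm1
    have h2 : m.toReal ≤ 1 / 2 := (ENNReal.toReal_le_of_le_ofReal (hb0 k).le hm2).trans (hbh k)
    refine le_trans ?_ (hprof _ ⟨(hb0 _).trans h1, h2⟩)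
    gcongr
    exact hI.mono (hb0 _) h1.le h2
  set J : ℕ → Set ℝ := fun k => Ioo (b (k + 1)) (b k) with hJ
  have hJsub : ∀ k, J k ⊆ Ioo 0 (1 / 2) := fun k =>
    Ioo_subset_Ioo (hb0 _).le (hbh k)
  have hJm : ∀ k, MeasurableSet (J k) := fun k => measurableSet_Ioo
  have hJd : Pairwise (Function.onFun Disjoint J) := by
    refine (pairwise_disjoint_on J).2 fun k l hkl => disjoint_left.2 fun x hx hx' => ?_
    exact (hx'.2.trans_le (hbanti (Nat.succ_le_of_lt hkl))).not_gt hx.1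
  have hJvol : ∀ k, volume (J k) = ENNReal.ofReal (b (k + 1)) := fun k => by
    rw [hJ, Real.volume_Ioo]; congr 1; linarith [hbs k]
  have hJunit : ∀ k, unitMeasure (J k) = ENNReal.ofReal (b (k + 1)) := fun k => by
    rw [unitMeasure, Measure.restrict_apply (hJm k), inter_eq_left.2, hJvol]
    exact (hJsub k).trans (Ioo_subset_Ioo_right (by norm_num))
  set φ : ℝ → ℝ≥0∞ := fun s =>
    ∑' k, (J k).indicator (fun _ => A k / ENNReal.ofReal (b (k + 1))) s with hφ
  have hφm : Measurable φ := Measurable.tsum fun k => measurable_const.indicator (hJm k)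
  have hφJ : ∀ k, ∀ s ∈ J k, φ s = A k / ENNReal.ofReal (b (k + 1)) := by
    intro k s hs
    simp only [hφ]
    rw [tsum_eq_single k fun l hl => ?_, indicator_of_mem hs]
    exact indicator_of_notMem (disjoint_left.1 (hJd hl.symm) hs) _
  have hφ0 : ∀ s, s ∉ ⋃ k, J k → φ s = 0 := by
    intro s hs
    simp only [hφ, ENNReal.tsum_eq_zero]
    exact fun k => indicator_of_notMem (fun hk => hs (mem_iUnion.2 ⟨k, hk⟩)) _
  have hXφ : X.bar φ ≤ X.normOn μ₁ h :=
    X.bar_le_normOn hφm.aemeasurable hhm.aemeasurable fun r _ =>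
      lintegral_transplant_sub_le hJm hJd hJunit (fun k => by simpa using hb0 (k + 1))
        (fun k => ENNReal.ofReal_ne_top) hEm hEd hEμ hφJ hφ0 r
  have hYQ : Y.bar (hardyOp I φ) ≤ c₀.toNNReal * X.normOn μ₁ h :=
    (hc₀ φ hφm.aemeasurable
      (fun s hs => hφ0 s fun hs' => hs (iUnion_subset hJsub hs')) (hXφ.trans_lt hfin)).trans
      (mul_le_mul' le_rfl hXφ)
  -- On `J k` the profile is at most I(b_k), so the Hardy integral there is at least A_k / I(b_k),
  -- which the band estimate bounds below.
  have hstep : ∀ k, δ * ENNReal.ofReal (T (k + 1) - T k) ≤ ∫⁻ s in J k, φ s / I s := by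
    intro k
    have hIb0 : I (b k) ≠ 0 := hI0 _ (hbmem k)
    have hIbt : I (b k) ≠ ∞ := hI.ne_top _ ⟨(hb0 _).le, by linarith [hbh k]⟩
    have hI2 : I (b k) ≤ 2 * I (b (k + 1)) := by
      have := hI.le_two_mul (t := b k) ⟨(hb0 _).le, by linarith [hbh k]⟩
      rwa [show b k / 2 = b (k + 1) by linarith [hbs k]] at this
    calc δ * ENNReal.ofReal (T (k + 1) - T k) ≤ A k / I (b k) := by
          rw [ENNReal.le_div_iff_mul_le (Or.inl hIb0) (Or.inl hIbt)]
          refine le_trans ?_ (hband k)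
          rw [hδ2]
          calc _ ≤ δ * ENNReal.ofReal (T (k + 1) - T k) * (2 * I (b (k + 1))) := by gcongr
            _ = _ := by ring
      _ = ∫⁻ _ in J k, A k / ENNReal.ofReal (b (k + 1)) / I (b k) := by
          rw [setLIntegral_const, hJvol, div_eq_mul_inv, div_eq_mul_inv, div_eq_mul_inv]
          rw [mul_right_comm (A k), mul_assoc (A k * _), ENNReal.inv_mul_cancel
            (by simpa using hb0 (k + 1)) ENNReal.ofReal_ne_top, mul_one]
      _ ≤ _ := by
          refine setLIntegral_mono' (hJm k) fun s hs => ?_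
          rw [hφJ k s hs]
          gcongr
          exact hI.mono ((hJsub k hs).1) hs.2.le (hbh k)
  have hQ : ∀ k, δ * ENNReal.ofReal (T k) ≤ hardyOp I φ (b k) := by
    intro k
    induction k with
    | zero => simp [hTzero]
    | succ k ih =>
      calc δ * ENNReal.ofReal (T (k + 1))
          = δ * ENNReal.ofReal (T (k + 1) - T k) + δ * ENNReal.ofReal (T k) := by
            rw [← mul_add, ← ENNReal.ofReal_add (sub_nonneg.2 (hTmono k.le_succ)) (hT0 k)]
            simp
        _ ≤ (∫⁻ s in J k, φ s / I s) + ∫⁻ s in Ioo (b k) 1, φ s / I s := add_le_add (hstep k) ih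
        _ = ∫⁻ s in J k ∪ Ioo (b k) 1, φ s / I s :=
            (lintegral_union measurableSet_Ioo
              (disjoint_left.2 fun s hs hs' => hs.2.not_gt hs'.1)).symm
        _ ≤ _ := lintegral_mono_set (union_subset
            (Ioo_subset_Ioo_right (by linarith [hbh k]))
            (Ioo_subset_Ioo_left (hbanti k.le_succ)))
  have hdil : ∀ t ∈ Ioo (0 : ℝ) (1 / 2),
      rearr μ₁ F (2 * t) ≤ (δ⁻¹ : ℝ≥0) * rearr unitMeasure (hardyOp I φ) t := by
    intro t ht
    have hex : ∃ k, b k ≤ 2 * t := by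
      obtain ⟨k, hk⟩ := exists_pow_lt_of_lt_one ht.1 (by norm_num : (1 / 2 : ℝ) < 1)
      refine ⟨k, ?_⟩
      simp only [hb, pow_succ]
      linarith [ht.1]
    -- For the least k with b_k ≤ 2t, either k = 0 and t < 1/2, or b_{k-1} = 2 b_k exceeds 2t.
    obtain ⟨k, hk1, hk2⟩ : ∃ k, b k ≤ 2 * t ∧ t < b k := by
      classical
      refine ⟨Nat.find hex, Nat.find_spec hex, ?_⟩
      rcases hk : Nat.find hex with _ | k
      · simpa [hb] using ht.2
      · have h1 := not_le.1 (Nat.find_min hex (m := k) (by omega))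
        linarith [hbs k]
    calc rearr μ₁ F (2 * t) ≤ ENNReal.ofReal (T k) := by rw [← hrT]; exact rearr_antitone F hk1
      _ = (δ⁻¹ : ℝ≥0) * (δ * ENNReal.ofReal (T k)) := by
          rw [← mul_assoc, ← ENNReal.coe_mul, inv_mul_cancel₀ hδ0.ne', ENNReal.coe_one, one_mul]
      _ ≤ _ := by
          gcongr
          exact (hQ k).trans (le_rearr_of_antitone (hardyOp_antitone I φ) (hb0 k) hk2
            (by linarith [hbh k]))
  refine Y.normOn_le fun g hg hY => ?_
  calc ∫⁻ s in Ioo (0 : ℝ) 1, rearr μ g s * rearr μ₁ F s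
      ≤ 2 * ∫⁻ s in Ioo (0 : ℝ) 1,
          rearr μ g s * ((δ⁻¹ : ℝ≥0) * rearr unitMeasure (hardyOp I φ) s) :=
        lintegral_mul_le_of_dilation (rearr_antitone g) hdil
    _ = 2 * ((δ⁻¹ : ℝ≥0) * ∫⁻ s in Ioo (0 : ℝ) 1,
          rearr μ g s * rearr unitMeasure (hardyOp I φ) s) := by
        rw [← lintegral_const_mul' _ _ ENNReal.coe_ne_top]
        congr 1
        exact lintegral_congr fun s => by ring
    _ ≤ 2 * ((δ⁻¹ : ℝ≥0) * (c₀.toNNReal * X.normOn μ₁ h)) := by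
        gcongr
        exact (Y.lintegral_le_bar _ hg hY).trans hYQ
    _ = _ := by push_cast; ring

end Transfer

end IsoTransfer

/-! ### From the median to the mean: the transference principle. -/

theorem mainTheorem6
    {Ω : Type*} [MetricSpace Ω] [MeasurableSpace Ω] (μ : Measure Ω)
    {Ω₁ : Type*} [MetricSpace Ω₁] [MeasurableSpace Ω₁] (μ₁ : Measure Ω₁)
    (hΩ : IsoTransfer.MetricProbSpace μ) (hΩ₁ : IsoTransfer.MetricProbSpace μ₁)
    (hardy : IsoTransfer.IsoHardyType μ)
    (hprofile : ∃ c : ℝ, 0 < c ∧ ∀ t ∈ Ioc (0 : ℝ) (1 / 2),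
      ENNReal.ofReal c * IsoTransfer.profile μ t ≤ IsoTransfer.profile μ₁ t)
    (X Y : IsoTransfer.RINorm μ)
    (hpoincare : IsoTransfer.PoincareInequality μ Y.norm X.norm) :
    IsoTransfer.PoincareInequality μ₁ (Y.normOn μ₁) (X.normOn μ₁) := by
  have := hΩ.prob
  have := hΩ₁.prob
  have := hΩ₁.borel
  obtain ⟨C, hC⟩ := IsoTransfer.exists_normOn_le_gradMod hΩ hΩ₁ ((hardy X Y).1 hpoincare) hprofile
  obtain ⟨K, hK⟩ := Y.exists_lintegral_le_normOn (ν := μ₁)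
  obtain ⟨D, hD⟩ := Y.exists_normOn_const_le (ν := μ₁)
  -- 4C bounds the distance to the median, K passes to L¹, D measures the constant m minus the mean,
  -- and 2 is the quasi-triangle constant. The final constant is M + 1 because it must be positive.
  set M : ℝ≥0 := 2 * (4 * C + D * (K * (4 * C))) with hM
  refine ⟨M + 1, by positivity, fun g hg hfin => ?_⟩
  have hgm : Measurable g := hg.continuous.measurable
  obtain ⟨m, hm1, hm2⟩ := IsoTransfer.exists_median (μ := μ₁) hgm
  set N := X.normOn μ₁ (IsoTransfer.gradMod g) with hN
  -- Stated for both g - m and m - g: `ENNReal.ofReal` keeps only the positive part, and the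
  -- gradient is that of g.
  have hpart : ∀ f : Ω₁ → ℝ, (∀ x y, |f x - f y| = |g x - g y|) →
      μ₁ {x | 0 < f x} ≤ ENNReal.ofReal (1 / 2) →
      Y.normOn μ₁ (fun x => ENNReal.ofReal (f x)) ≤ C * N := by
    intro f hf hhalf
    have hgrad : IsoTransfer.gradMod f = IsoTransfer.gradMod g := by
      funext x; simp only [IsoTransfer.gradMod, hf]
    have hlip : IsoTransfer.LipOnBalls f :=
      hg.of_abs_sub_le le_rfl fun x y => by rw [hf]; simp
    have h1 := hC f hlip hhalf
    rw [hgrad] at h1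
    exact h1 hfin
  have h1 := hpart (fun x => g x - m) (fun x y => by simp) (by simpa using hm1)
  have h2 := hpart (fun x => m - g x) (fun x y => by rw [abs_sub_comm (g x)]; simp)
    (by simpa using hm2)
  have habs : ∀ x, ‖g x - m‖ₑ = ENNReal.ofReal (g x - m) + ENNReal.ofReal (m - g x) := by
    intro x
    rw [Real.enorm_eq_ofReal_abs]
    rcases le_total m (g x) with h | h
    · rw [abs_of_nonneg (sub_nonneg.2 h), ENNReal.ofReal_of_nonpos (sub_nonpos.2 h), add_zero]
    · rw [abs_of_nonpos (sub_nonpos.2 h), ENNReal.ofReal_of_nonpos (sub_nonpos.2 h), zero_add,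
        neg_sub]
  have hmed : Y.normOn μ₁ (fun x => ‖g x - m‖ₑ) ≤ 4 * C * N := by
    simp only [habs]
    calc _ ≤ 2 * (C * N + C * N) := (Y.normOn_add_le _ _).trans (by gcongr)
      _ = _ := by ring
  have hL1 : ∫⁻ x, ‖g x - m‖ₑ ∂μ₁ ≤ K * (4 * C * N) :=
    (hK _ (hgm.sub_const m).enorm.aemeasurable).trans (by gcongr)
  have hint : Integrable (fun x => g x - m) μ₁ :=
    ⟨(hgm.sub_const m).aestronglyMeasurable, hL1.trans_lt
      (ENNReal.mul_lt_top ENNReal.coe_lt_top (ENNReal.mul_lt_top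
        (ENNReal.mul_lt_top ENNReal.ofNat_lt_top ENNReal.coe_lt_top) hfin))⟩
  have hgint : Integrable g μ₁ :=
    (hint.add (integrable_const m)).congr (Eventually.of_forall fun x => by simp)
  refine ⟨hgint, ?_⟩
  have hmean : ‖m - ∫ y, g y ∂μ₁‖ₑ ≤ K * (4 * C * N) := by
    have : ∫ y, g y ∂μ₁ - m = ∫ y, (g y - m) ∂μ₁ := by
      rw [integral_sub hgint (integrable_const m)]; simp
    rw [← enorm_neg, neg_sub, this]
    exact (enorm_integral_le_lintegral_enorm _).trans hL1
  calc Y.normOn μ₁ (fun x => ‖g x - ∫ y, g y ∂μ₁‖ₑ)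
      ≤ Y.normOn μ₁ (fun x => ‖g x - m‖ₑ + ‖m - ∫ y, g y ∂μ₁‖ₑ) :=
        Y.normOn_mono fun x => by
          rw [← sub_add_sub_cancel (g x) m]
          exact enorm_add_le _ _
    _ ≤ 2 * (4 * C * N + D * (K * (4 * C * N))) :=
        (Y.normOn_add_le _ _).trans (by
          gcongr
          exact (hD _).trans (by gcongr))
    _ = M * N := by rw [hM]; push_cast; ring
    _ ≤ ENNReal.ofReal (M + 1) * N := by
        gcongr
        rw [← ENNReal.ofReal_coe_nnreal]
        exact ENNReal.ofReal_le_ofReal (by linarith)
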